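/- Let $\mathbb X$ be a Polish space with a metric generating its topology, with its Borel $\sigma$-field, and let $\mathbb R^+=(0,\infty)$. Let $\eta$ be a non-atomic probability measure on $\mathbb X$, let $x\mapsto\rho_x$ be an ($s$-finite) kernel from $\mathbb X$ to $\mathbb R^+$, and suppose that $\nu(dx,ds)=\eta(dx)\rho_x(ds)$ satisfies $\int_{A\times\mathbb R^+}\min(s,t)\,\nu(dx,ds)<\infty$ for all bounded Borel sets $A$ and all $t>0$. Let $N$ be a Poisson process on $\mathbb X\times\mathbb R^+$ with intensity $\nu$, and let $\widetilde\mu(\cdot)=\int_{\mathbb R^+}s\,N(\cdot,ds)$ be the associated completely random measure, with law $\mathcal P_{\widetilde\mu}$. Assume that $0<\widetilde\mu(\mathbb X)<\infty$ almost surely. Let $q\ge 0$, let $h':[0,\infty)\to(0,\infty)$ be Borel measurable with $E[h'(\widetilde\mu(\mathbb X))\,\widetilde\mu(\mathbb X)^{-q}]<\infty$, and let $\widetilde\mu_t$ be a random measure with the tilted law $$\mathcal P_{\widetilde\mu_t}(A)=\frac{1}{E[h'(\widetilde\mu(\mathbb X))\widetilde\mu(\mathbb X)^{-q}]}\int_A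 h'(\mu(\mathbb X))\,\mu(\mathbb X)^{-q}\,\mathcal P_{\widetilde\mu}(d\mu).$$ Put $\widetilde G_t=\widetilde\mu_t/\widetilde\mu_t(\mathbb X)$, and let $X_1,\dots,X_n$ be, conditionally on $\widetilde\mu_t$, independent with common distribution $\widetilde G_t$. Write $\mathbf X_n=(X_1,\dots,X_n)$, let $Y_1,\dots,Y_K$ be its distinct values and $n_k=\#\{i:X_i=Y_k\}$. Then there is a regular version $\mathcal P_{\widetilde\mu_t}^{(\mathbf X_n)}$ of the conditional distribution of $\widetilde\mu_t$ given $\mathbf X_n$ such that the image of $\mathcal P_{\widetilde\mu_t}^{(\mathbf X_n)}$ under $\mu\mapsto\mu/\mu(\mathbb X)$ is a version of the conditional distribution of $\widetilde G_t$ given $\mathbf X_n$, and such that the following holds for almost every value of $\mathbf X_n$. 1. Suppose that $\int_{\mathbb R^+}s^{n_k}\rho_{Y_k}(ds)<\infty$ for $k=1,\dots,K$. Then these integrals are positive. Let $\mathcal P_{\widetilde\mu}^{(\mathbf X_n)}$ be the law of $$\widetilde\mu^{(\mathbf X_n)}=\widetilde\mu+\sum_{k=1}^{K}J_k\,\delta_{Y_k},$$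 where $\widetilde\mu$ has law $\mathcal P_{\widetilde\mu}$, where $\mathbb P(J_k\in ds)=s^{n_k}\rho_{Y_k}(ds)\big/\int_{\mathbb R^+}s^{n_k}\rho_{Y_k}(ds)$, and where $\widetilde\mu,J_1,\dots,J_K$ are independent. Then $$0<E\big[h'(\widetilde\mu^{(\mathbf X_n)}(\mathbb X))\,\widetilde\mu^{(\mathbf X_n)}(\mathbb X)^{-(n+q)}\big]<\infty$$ and, for every measurable set $A$ of measures on $\mathbb X$, $$\mathcal P_{\widetilde\mu_t}^{(\mathbf X_n)}(A)=\frac{\int_A h'(\mu(\mathbb X))\,\mu(\mathbb X)^{-(n+q)}\,\mathcal P_{\widetilde\mu}^{(\mathbf X_n)}(d\mu)}{E\big[h'(\widetilde\mu^{(\mathbf X_n)}(\mathbb X))\,\widetilde\mu^{(\mathbf X_n)}(\mathbb X)^{-(n+q)}\big]}.$$ 2. Whether or not these integrals are finite, the same formula holds with $\mathcal P_{\widetilde\mu}^{(\mathbf X_n)}$ replaced by the (possibly infinite) image of the product measure $\mathcal P_{\widetilde\mu}(d\mu)\prod_{k=1}^{K}s_k^{n_k}\rho_{Y_k}(ds_k)$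 under $(\mu,s_1,\dots,s_K)\mapsto\mu+\sum_{k=1}^{K}s_k\delta_{Y_k}$, and with the normalizing expectation replaced by the integral of $h'(\mu(\mathbb X))\,\mu(\mathbb X)^{-(n+q)}$ against this measure, which lies in $(0,\infty)$. -/

import Mathlib

open MeasureTheory ProbabilityTheory
open scoped ENNReal NNReal

noncomputable section

namespace TiltedCRM

/-- The positive half-line `ℝ⁺ = (0, ∞)`, where jump sizes live. -/
abbrev PosReal : Type := ↥(Set.Ioi (0 : ℝ))

/-- A jump size as an extended non-negative real. -/
def PosReal.toENNReal (s : PosReal) : ℝ≥0∞ := ENNReal.ofReal (s : ℝ)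

/-- `N` is a Poisson process (Poisson random measure) on `E` with intensity `ν`, defined on the
probability space `(Ω, P)`: a random measure such that `N(A)` has the Poisson distribution with
mean `ν(A)` whenever `ν(A) < ∞`, and whose values on finitely many pairwise disjoint measurable
sets are independent. -/
structure IsPoissonProcess {E Ω : Type*} [MeasurableSpace E] [MeasurableSpace Ω]
    (N : Ω → Measure E) (ν : Measure E) (P : Measure Ω) : Prop where
  measurable : Measurable N
  map_apply_eq : ∀ A : Set E, MeasurableSet A → ν A ≠ ∞ →
    P.map (fun ω => N ω A) =
      (poissonMeasure (ν A).toNNReal).map (fun k : ℕ => (k : ℝ≥0∞))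
  iIndepFun_apply : ∀ (k : ℕ) (A : Fin k → Set E), (∀ i, MeasurableSet (A i)) →
    (∀ i j, i ≠ j → Disjoint (A i) (A j)) → iIndepFun (fun i ω => N ω (A i)) P

/-- The integrability condition on the intensity measure `ν` of a completely random measure:
`∫_{A × ℝ⁺} min (s, t) ν(dx, ds) < ∞` for all bounded Borel sets `A` and all `t > 0`. -/
def IsCRMIntensity {𝕏 : Type*} [MetricSpace 𝕏] [MeasurableSpace 𝕏]
    (ν : Measure (𝕏 × PosReal)) : Prop :=
  ∀ A : Set 𝕏, MeasurableSet A → Bornology.IsBounded A → ∀ t : ℝ, 0 < t →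
    ∫⁻ p in A ×ˢ Set.univ, min p.2.toENNReal (ENNReal.ofReal t) ∂ν < ∞

/-- The measure `A ↦ ∫ s N(A, ds)` on `𝕏` built from a measure `N` on `𝕏 × ℝ⁺`. -/
def crmOf {𝕏 : Type*} [MeasurableSpace 𝕏] (N : Measure (𝕏 × PosReal)) : Measure 𝕏 :=
  (N.withDensity fun p => p.2.toENNReal).map Prod.fst

/-- The normalized measure `μ(·) / μ(𝕏)`. -/
def normalizeMeasure {𝕏 : Type*} [MeasurableSpace 𝕏] (μ : Measure 𝕏) : Measure 𝕏 :=
  (μ Set.univ)⁻¹ • μ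

/-- The constant `∫ h(μ(𝕏)) Q(dμ)`, that is `E[h(μ(𝕏))]` when `Q` is the law of the random
measure `μ`. It is used for laws under which `μ(𝕏)` is almost surely finite. -/
def tiltConst {𝕏 : Type*} [MeasurableSpace 𝕏] (Q : Measure (Measure 𝕏)) (h : ℝ≥0 → ℝ) : ℝ≥0∞ :=
  ∫⁻ μ, ENNReal.ofReal (h (μ Set.univ).toNNReal) ∂Q

/-- The tilted law `A ↦ (∫ h(μ(𝕏)) Q(dμ))⁻¹ ∫_A h(μ(𝕏)) Q(dμ)`. -/
def tiltedLaw {𝕏 : Type*} [MeasurableSpace 𝕏] (Q : Measure (Measure 𝕏)) (h : ℝ≥0 → ℝ) :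
    Measure (Measure 𝕏) :=
  (tiltConst Q h)⁻¹ • Q.withDensity fun μ => ENNReal.ofReal (h (μ Set.univ).toNNReal)

/-- The tilting function `x ↦ h'(x) x^{-r}`. -/
def polyTilt (h' : ℝ≥0 → ℝ) (r : ℝ) : ℝ≥0 → ℝ := fun x => h' x * (x : ℝ) ^ (-r)

/-- The observations `X₁, …, Xₙ` are independent and identically distributed with distribution
`M / M(𝕏)`, conditionally on the random measure `M`:
`P'(M ∈ A, X₁ ∈ B₁, …, Xₙ ∈ Bₙ) = E[1{M ∈ A} ∏ᵢ M(Bᵢ) / M(𝕏)]`. -/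
structure IsCondIIDSample {𝕏 Ω' : Type*} [MeasurableSpace 𝕏] [MeasurableSpace Ω'] {n : ℕ}
    (X : Fin n → Ω' → 𝕏) (M : Ω' → Measure 𝕏) (P' : Measure Ω') : Prop where
  measurable_obs : ∀ i, Measurable (X i)
  joint_law : ∀ A : Set (Measure 𝕏), MeasurableSet A →
    ∀ B : Fin n → Set 𝕏, (∀ i, MeasurableSet (B i)) →
      P' {ω | M ω ∈ A ∧ ∀ i, X i ω ∈ B i} =
        ∫⁻ ω in M ⁻¹' A, ∏ i, normalizeMeasure (M ω) (B i) ∂P'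

/-- The kernel `κ` is a version of the conditional distribution (posterior) of `Θ` given `X`. -/
def IsCondLaw {S T Ω' : Type*} [MeasurableSpace S] [MeasurableSpace T] [MeasurableSpace Ω']
    (κ : Kernel S T) (Θ : Ω' → T) (X : Ω' → S) (P' : Measure Ω') : Prop :=
  IsMarkovKernel κ ∧ P'.map (fun ω => (X ω, Θ ω)) = (P'.map X) ⊗ₘ κ

open Classical in
/-- The set `{Y₁, …, Y_K}` of distinct values of the sample `x₁, …, xₙ`. -/
def distinctValues {𝕏 : Type*} {n : ℕ} (x : Fin n → 𝕏) : Finset 𝕏 := Finset.univ.image x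

open Classical in
/-- The number of indices `i` with `xᵢ = y`. -/
def multiplicity {𝕏 : Type*} {n : ℕ} (x : Fin n → 𝕏) (y : 𝕏) : ℕ :=
  (Finset.univ.filter fun i => x i = y).card

/-- The measure `s^m ρ_y(ds)` on `ℝ⁺`. -/
def jumpMeasure {𝕏 : Type*} [MeasurableSpace 𝕏] (ρ : Kernel 𝕏 PosReal) (y : 𝕏) (m : ℕ) :
    Measure PosReal :=
  (ρ y).withDensity fun s => s.toENNReal ^ m

/-- The moment `∫ s^m ρ_y(ds)`. -/
def jumpMoment {𝕏 : Type*} [MeasurableSpace 𝕏] (ρ : Kernel 𝕏 PosReal) (y : 𝕏) (m : ℕ) : ℝ≥0∞ :=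
  ∫⁻ s, s.toENNReal ^ m ∂(ρ y)

/-- The jump distribution `s^m ρ_y(ds) / ∫ s^m ρ_y(ds)`. -/
def jumpLaw {𝕏 : Type*} [MeasurableSpace 𝕏] (ρ : Kernel 𝕏 PosReal) (y : 𝕏) (m : ℕ) :
    Measure PosReal :=
  (jumpMoment ρ y m)⁻¹ • jumpMeasure ρ y m

/-- The law of `μ + ∑ₖ Jₖ δ_{Yₖ}`, where `Y₁, …, Y_K` are the distinct values of `x`, with
multiplicities `n₁, …, n_K`, where `μ` has law `Q`, the `Jₖ` have laws `j Yₖ nₖ`, and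
`μ, J₁, …, J_K` are independent. If the `j y m` are just σ-finite measures, this is the image of
the product of `Q` and of the `j Yₖ nₖ` under `(μ, s₁, …, s_K) ↦ μ + ∑ₖ sₖ δ_{Yₖ}`. -/
def addJumpsLaw {𝕏 : Type*} [MeasurableSpace 𝕏] {n : ℕ} (Q : Measure (Measure 𝕏))
    (j : 𝕏 → ℕ → Measure PosReal) (x : Fin n → 𝕏) : Measure (Measure 𝕏) :=
  (Q.prod (Measure.pi fun y : ↥(distinctValues x) => j y (multiplicity x y))).map
    fun p => p.1 + ∑ y : ↥(distinctValues x), (p.2 y).toENNReal • Measure.dirac (y : 𝕏)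

end TiltedCRM

end

/-! The posterior is Bayes' formula once the joint law of the random measure and the sample is
known. Write `T` for the total mass of `μ`. As `0 < T < ∞` almost surely, the `n` normalizing
factors `1 / T` join the tilt `h'(T) T^{-q}`, so the probability of `μt ∈ A`, `Xᵢ ∈ Bᵢ` is, up to
the tilting constant, the integral of `1_A(μ) h'(T) T^{-(n+q)} ∏ᵢ μ(Bᵢ)` under the untilted law `Q`
(`tiltDensity_mul_prod_normalizeMeasure`).

The multivariate Mecke formula `MeckeFormula.lintegral_mul_prod` disintegrates this over the sample:
each factor `μ(Bᵢ)` either opens a new jump of the Poisson process, at a location drawn from `η`, or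
hits a jump already opened and weights it by a further factor `s`. What results is `Q` with
independent jumps `s^{n_k} ρ_{Y_k}(ds)` added at the distinct values, integrated against
`partitionMeasure`. The density of the sample is then the normalizing constant of the posterior,
which is therefore finite and positive almost surely (`isCondLaw_posteriorKernel`).

The formula is proved by induction on `n` from the one-point Mecke formula for `Q`, which comes from
that of the Poisson process. The latter rests on the identity `k r^k / k! = r · r^{k-1} / (k-1)!`
for Poisson weights, on independence over disjoint sets, and on a π-system argument.

When the jump measures are finite, normalizing them only rescales the law with added jumps, and a
tilted law is insensitive to scale. Thus the first claim reduces to the second. -/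

namespace TiltedCRM

noncomputable section

/-! ### The Mecke formula for Poisson processes. -/

section PoissonMecke

/-- Size-biasing a Poisson variable shifts it by one. This is the Mecke formula for the count in a
single set. -/
lemma lintegral_mul_poissonMeasure (r : ℝ≥0) (φ : ℝ≥0∞ → ℝ≥0∞) :
    ∫⁻ k : ℕ, (k : ℝ≥0∞) * φ k ∂poissonMeasure r
      = r * ∫⁻ k : ℕ, φ ((k : ℝ≥0∞) + 1) ∂poissonMeasure r := by
  simp only [poissonMeasure, lintegral_sum_measure, lintegral_smul_measure, lintegral_dirac,
    smul_eq_mul]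
  rw [tsum_eq_zero_add' ENNReal.summable, ← ENNReal.tsum_mul_left]
  simp only [Nat.cast_zero, zero_mul, mul_zero, zero_add]
  refine tsum_congr fun k => ?_
  have key : ENNReal.ofReal (Real.exp (-r) * (r : ℝ) ^ (k + 1) / ((k + 1).factorial : ℝ))
      * ((k + 1 : ℕ) : ℝ≥0∞)
      = r * ENNReal.ofReal (Real.exp (-r) * (r : ℝ) ^ k / (k.factorial : ℝ)) := by
    rw [← ENNReal.ofReal_natCast, ← ENNReal.ofReal_coe_nnreal (p := r),
      ← ENNReal.ofReal_mul (by positivity), ← ENNReal.ofReal_mul (by positivity)]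
    congr 1
    rw [Nat.factorial_succ]
    push_cast
    field_simp
    ring
  rw [← mul_assoc, key, mul_assoc, Nat.cast_add, Nat.cast_one]

variable {E Ω : Type*} [MeasurableSpace E] [MeasurableSpace Ω]
  {N : Ω → Measure E} {ν : Measure E} {P : Measure Ω}

lemma IsPoissonProcess.measurable_apply (hN : IsPoissonProcess N ν P) {A : Set E}
    (hA : MeasurableSet A) : Measurable fun ω => N ω A :=
  (Measure.measurable_coe hA).comp hN.measurable

lemma IsPoissonProcess.lintegral_mul_apply (hN : IsPoissonProcess N ν P) {A : Set E}
    (hA : MeasurableSet A) (hνA : ν A ≠ ∞) {φ : ℝ≥0∞ → ℝ≥0∞} (hφ : Measurable φ) :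
    ∫⁻ v, v * φ v ∂P.map (fun ω => N ω A)
      = ν A * ∫⁻ v, φ (v + 1) ∂P.map (fun ω => N ω A) := by
  rw [hN.map_apply_eq A hA hνA, lintegral_map (by fun_prop) .of_discrete,
    lintegral_map (by fun_prop) .of_discrete, lintegral_mul_poissonMeasure,
    ENNReal.coe_toNNReal hνA]

lemma IsPoissonProcess.lintegral_apply (hN : IsPoissonProcess N ν P) [IsProbabilityMeasure P]
    {A : Set E} (hA : MeasurableSet A) (hνA : ν A ≠ ∞) : ∫⁻ ω, N ω A ∂P = ν A := by
  have h := hN.lintegral_mul_apply hA hνA (φ := fun _ => 1) measurable_const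
  have : IsProbabilityMeasure (P.map fun ω => N ω A) :=
    Measure.isProbabilityMeasure_map (hN.measurable_apply hA).aemeasurable
  simp only [mul_one, lintegral_const, measure_univ] at h
  exact (lintegral_map (f := id) measurable_id (hN.measurable_apply hA)).symm.trans h

/-- A finite measurable partition is encoded by the map `c` sending a point to the label of its
cell; distinct fibres are disjoint. -/
lemma IsPoissonProcess.iIndepFun_fiber (hN : IsPoissonProcess N ν P) {ι : Type*} [Fintype ι]
    {c : E → ι} (hc : ∀ i, MeasurableSet (c ⁻¹' {i})) :
    iIndepFun (fun i ω => N ω (c ⁻¹' {i})) P := by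
  let e := Fintype.equivFin ι
  have h := hN.iIndepFun_apply _ (fun k => c ⁻¹' {e.symm k}) (fun k => hc _) fun i j hij => by
    refine Disjoint.preimage _ ?_
    simpa using hij
  simpa using iIndepFun.precomp e.injective h

/-- By independence the counts in the other cells can be frozen, and the size-biasing identity
applied to the count in cell `i` alone. -/
lemma IsPoissonProcess.lintegral_fiber (hN : IsPoissonProcess N ν P) [IsProbabilityMeasure P]
    {ι : Type*} [Fintype ι] [DecidableEq ι] {c : E → ι} (hc : ∀ i, MeasurableSet (c ⁻¹' {i}))
    (i : ι) (hi : ν (c ⁻¹' {i}) ≠ ∞) {Φ : (ι → ℝ≥0∞) → ℝ≥0∞} (hΦ : Measurable Φ) :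
    ∫⁻ ω, N ω (c ⁻¹' {i}) * Φ (fun j => N ω (c ⁻¹' {j})) ∂P
      = ν (c ⁻¹' {i}) *
        ∫⁻ ω, Φ (fun j => N ω (c ⁻¹' {j}) + if j = i then 1 else 0) ∂P := by
  let V : Ω → ℝ≥0∞ := fun ω => N ω (c ⁻¹' {i})
  let W : Ω → ({i}ᶜ : Finset ι) → ℝ≥0∞ := fun ω j => N ω (c ⁻¹' {(j : ι)})
  have hV : Measurable V := hN.measurable_apply (hc i)
  have hW : Measurable W := measurable_pi_iff.2 fun j => hN.measurable_apply (hc j)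
  have hind : IndepFun V W P := by
    have h := (hN.iIndepFun_fiber hc).indepFun_finset {i} {i}ᶜ disjoint_compl_right
      fun j => hN.measurable_apply (hc j)
    have hφ : Measurable fun v : ({i} : Finset ι) → ℝ≥0∞ => v ⟨i, Finset.mem_singleton_self i⟩ :=
      measurable_pi_apply _
    exact h.comp hφ measurable_id
  -- Reassembles the full vector of counts from the count `v` in cell `i` and the counts `w` in the
  -- others.
  let join : ℝ≥0∞ → (({i}ᶜ : Finset ι) → ℝ≥0∞) → ι → ℝ≥0∞ := fun v w j =>
    if h : j = i then v else w ⟨j, by simpa using h⟩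
  have hjoin : Measurable fun p : ℝ≥0∞ × (({i}ᶜ : Finset ι) → ℝ≥0∞) => join p.1 p.2 := by
    refine measurable_pi_iff.2 fun j => ?_
    by_cases h : j = i
    · simpa [join, h] using measurable_fst
    · simp only [join, h, dite_false]
      fun_prop
  have hmap := (indepFun_iff_map_prod_eq_prod_map_map hV.aemeasurable hW.aemeasurable).1 hind
  have := Measure.isProbabilityMeasure_map hV.aemeasurable (μ := P)
  have := Measure.isProbabilityMeasure_map hW.aemeasurable (μ := P)
  have e1 : ∀ ω, Φ (fun j => N ω (c ⁻¹' {j})) = Φ (join (V ω) (W ω)) := fun ω => by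
    congr 1; funext j; by_cases h : j = i <;> simp [join, V, W, h]
  have e2 : ∀ ω, Φ (fun j => N ω (c ⁻¹' {j}) + if j = i then 1 else 0)
      = Φ (join (V ω + 1) (W ω)) := fun ω => by
    congr 1; funext j; by_cases h : j = i <;> simp [join, V, W, h]
  simp only [e1, e2]
  have m1 : Measurable fun p : ℝ≥0∞ × (({i}ᶜ : Finset ι) → ℝ≥0∞) => p.1 * Φ (join p.1 p.2) :=
    measurable_fst.mul (hΦ.comp hjoin)
  have m2 : Measurable fun p : ℝ≥0∞ × (({i}ᶜ : Finset ι) → ℝ≥0∞) => Φ (join (p.1 + 1) p.2) :=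
    hΦ.comp (hjoin.comp ((measurable_fst.add_const 1).prodMk measurable_snd))
  have l1 := lintegral_map m1 (hV.prodMk hW) (μ := P)
  have l2 := lintegral_map m2 (hV.prodMk hW) (μ := P)
  simp only [V] at l1 l2 hmap ⊢
  rw [← l1, ← l2, hmap, lintegral_prod_symm' _ m1, lintegral_prod_symm' _ m2,
    ← lintegral_const_mul _ m2.lintegral_prod_left']
  refine lintegral_congr fun w => ?_
  exact hN.lintegral_mul_apply (hc i) hi (φ := fun v => Φ (join v w))
    (hΦ.comp (hjoin.comp measurable_prodMk_right))


/-- Adding a point mass at `p` raises by one exactly the count of the cell containing `p`, so the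
shifts of the single-cell identities, summed over the cells in `s`, become an integral over `p`. -/
lemma IsPoissonProcess.lintegral_mul_fiber (hN : IsPoissonProcess N ν P) [IsProbabilityMeasure P]
    {ι : Type*} [Fintype ι] {c : E → ι} (hc : ∀ i, MeasurableSet (c ⁻¹' {i}))
    (s : Finset ι) (hs : ν (c ⁻¹' s) ≠ ∞) {Φ : (ι → ℝ≥0∞) → ℝ≥0∞} (hΦ : Measurable Φ) :
    ∫⁻ ω, N ω (c ⁻¹' s) * Φ (fun j => N ω (c ⁻¹' {j})) ∂P
      = ∫⁻ p in c ⁻¹' s, ∫⁻ ω, Φ (fun j => (N ω + Measure.dirac p) (c ⁻¹' {j})) ∂P ∂ν := by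
  classical
  have hfib : Measurable fun ω => Φ fun j => N ω (c ⁻¹' {j}) :=
    hΦ.comp (measurable_pi_iff.2 fun j => hN.measurable_apply (hc j))
  have hU : c ⁻¹' (s : Set ι) = ⋃ i ∈ s, c ⁻¹' {i} := by ext; simp
  have hdisj : Set.PairwiseDisjoint (s : Set ι) fun i => c ⁻¹' {i} := fun i _ j _ hij =>
    Disjoint.preimage _ (by simpa using hij)
  rw [hU, lintegral_biUnion_finset hdisj (fun i _ => hc i), ← hU]
  simp only [← sum_measure_preimage_singleton s fun y _ => hc y, Finset.sum_mul]
  rw [lintegral_finsetSum (f := fun i ω => N ω (c ⁻¹' {i}) * Φ fun j => N ω (c ⁻¹' {j})) _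
    fun i _ => (hN.measurable_apply (hc i)).mul hfib]
  refine Finset.sum_congr rfl fun i hi => ?_
  have hνi : ν (c ⁻¹' {i}) ≠ ∞ :=
    ne_top_of_le_ne_top hs (measure_mono (Set.preimage_mono (by simpa using hi)))
  rw [hN.lintegral_fiber hc i hνi hΦ, mul_comm, ← setLIntegral_const]
  refine setLIntegral_congr_fun (hc i) fun p hp => lintegral_congr fun ω => ?_
  congr 1
  funext j
  have hp : c p = i := hp
  simp [Measure.dirac_apply' _ (hc j), Set.indicator_apply, hp, eq_comm]

lemma measurable_add_dirac (hN : Measurable N) :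
    Measurable fun q : E × Ω => N q.2 + Measure.dirac q.1 :=
  Measure.measurable_of_measurable_coe _ fun B hB => by
    simp only [Measure.add_apply]
    exact ((Measure.measurable_coe hB).comp (hN.comp measurable_snd)).add
      ((Measure.measurable_coe hB).comp (Measure.measurable_dirac.comp measurable_fst))

/-- The cylinders are the events constraining the values of a measure on finitely many sets. -/
lemma isPiSystem_cylinders (E : Type*) [MeasurableSpace E] :
    IsPiSystem (piiUnionInter
      (fun C : {C : Set E // MeasurableSet C} =>
        {A | MeasurableSet[(borel ℝ≥0∞).comap fun m : Measure E => m C] A}) Set.univ) :=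
  isPiSystem_piiUnionInter _ (fun _ => @MeasurableSpace.isPiSystem_measurableSet _ (_)) _

lemma generateFrom_cylinders (E : Type*) [MeasurableSpace E] :
    (Measure.instMeasurableSpace : MeasurableSpace (Measure E)) =
      MeasurableSpace.generateFrom (piiUnionInter
      (fun C : {C : Set E // MeasurableSet C} =>
        {A | MeasurableSet[(borel ℝ≥0∞).comap fun m : Measure E => m C] A}) Set.univ) := by
  rw [generateFrom_piiUnionInter_measurableSet
    (fun C : {C : Set E // MeasurableSet C} => (borel ℝ≥0∞).comap fun m : Measure E => m C)]
  simp [Measure.instMeasurableSpace, iSup_subtype]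

/-- The Mecke formula on sets of finite intensity. -/
lemma IsPoissonProcess.setLIntegral_apply (hN : IsPoissonProcess N ν P) [IsProbabilityMeasure P]
    {A : Set (Measure E)} (hA : MeasurableSet A) {B : Set E} (hB : MeasurableSet B)
    (hνB : ν B ≠ ∞) :
    ∫⁻ ω in N ⁻¹' A, N ω B ∂P = ∫⁻ p in B, P {ω | N ω + Measure.dirac p ∈ A} ∂ν := by
  classical
  have : IsFiniteMeasure (ν.restrict B) := isFiniteMeasure_restrict.2 hνB
  let m₁ : Measure (Measure E) := (P.withDensity fun ω => N ω B).map N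
  let m₂ : Measure (Measure E) := ((ν.restrict B).prod P).map fun q => N q.2 + Measure.dirac q.1
  have hm₁ : ∀ A, MeasurableSet A → m₁ A = ∫⁻ ω in N ⁻¹' A, N ω B ∂P := fun A hA => by
    rw [Measure.map_apply hN.measurable hA, withDensity_apply _ (hN.measurable hA)]
  have hm₂ : ∀ A, MeasurableSet A →
      m₂ A = ∫⁻ p in B, P {ω | N ω + Measure.dirac p ∈ A} ∂ν := fun A hA => by
    rw [Measure.map_apply (measurable_add_dirac hN.measurable) hA,
      Measure.prod_apply (measurable_add_dirac hN.measurable hA)]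
    rfl
  have h₁univ : m₁ Set.univ = ν B := by
    rw [hm₁ _ .univ, Set.preimage_univ, Measure.restrict_univ, hN.lintegral_apply hB hνB]
  -- Finiteness of `ν B` enters here: uniqueness on a π-system requires finite mass.
  have hfin : IsFiniteMeasure m₁ := ⟨by rw [h₁univ]; exact hνB.lt_top⟩
  suffices h : m₁ = m₂ by rw [← hm₁ A hA, ← hm₂ A hA, h]
  refine ext_of_generate_finite _ (generateFrom_cylinders E) (isPiSystem_cylinders E) ?_ ?_
  swap
  · rw [h₁univ, hm₂ _ .univ]; simp
  rintro A' ⟨t, -, f, hf, rfl⟩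
  choose! S hS hSf using hf
  have hA' : MeasurableSet (⋂ x ∈ t, f x) :=
    t.measurableSet_biInter fun x hx => by
      rw [← hSf x hx]; exact Measure.measurable_coe x.2 (hS x hx)
  -- The label of a point records which of the finitely many sets defining the cylinder, and whether
  -- `B`, contain it. All these sets are unions of cells, so the cylinder event is a function `Φ` of
  -- the cell counts.
  let c : E → (t → Prop) × Prop := fun p => (fun x => p ∈ (x : {C : Set E // MeasurableSet C}).1,
    p ∈ B)
  have hc' : Measurable c :=
    (measurable_pi_iff.2 fun x => x.1.2.mem).prodMk hB.mem
  have hc : ∀ i, MeasurableSet (c ⁻¹' {i}) := fun i => hc' (measurableSet_singleton i)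
  let Φ : ((t → Prop) × Prop → ℝ≥0∞) → ℝ≥0∞ :=
    Set.indicator {v | ∀ x : t, ∑ i with i.1 x, v i ∈ S x} 1
  have hΦ : Measurable Φ := by
    refine measurable_one.indicator ?_
    simp only [Set.ofPred_forall]
    refine MeasurableSet.iInter fun x => ?_
    exact (Finset.measurable_sum _ fun i _ => measurable_pi_apply i) (hS x x.2)
  have hΦA : ∀ m : Measure E, Φ (fun i => m (c ⁻¹' {i})) = (⋂ x ∈ t, f x).indicator 1 m := by
    intro m
    simp only [Φ, Set.indicator_apply]
    congr 1
    simp only [Set.mem_ofPred_eq, Set.mem_iInter, sum_measure_preimage_singleton _ fun y _ => hc y,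
      eq_iff_iff]
    rw [Subtype.forall]
    refine forall₂_congr fun x hx => ?_
    have hpre : c ⁻¹' ((Finset.univ.filter fun i : (t → Prop) × Prop => i.1 ⟨x, hx⟩ : Finset _) :
        Set ((t → Prop) × Prop)) = x.1 := by
      ext p; simp [c]
    rw [← hSf x hx, hpre]
    rfl
  have hpreB : c ⁻¹' ((Finset.univ.filter fun i : (t → Prop) × Prop => i.2 : Finset _) :
      Set ((t → Prop) × Prop)) = B := by
    ext p; simp [c]
  have key := hN.lintegral_mul_fiber hc (Finset.univ.filter fun i => i.2) (by rwa [hpreB]) hΦ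
  simp only [hpreB, hΦA] at key
  rw [hm₁ _ hA', hm₂ _ hA', ← lintegral_indicator (hN.measurable hA')]
  convert key using 2
  · funext ω
    by_cases h : N ω ∈ ⋂ x ∈ t, f x <;> simp [h, Set.mem_preimage]
  · funext p
    exact (lintegral_indicator_one (hA'.preimage
      ((measurable_add_dirac hN.measurable).comp measurable_prodMk_left))).symm

/-- The Mecke formula. -/
theorem IsPoissonProcess.mecke (hN : IsPoissonProcess N ν P) [IsProbabilityMeasure P]
    [SigmaFinite ν] {A : Set (Measure E)} (hA : MeasurableSet A) {f : E → ℝ≥0∞}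
    (hf : Measurable f) :
    ∫⁻ ω in N ⁻¹' A, ∫⁻ p, f p ∂N ω ∂P
      = ∫⁻ p, P {ω | N ω + Measure.dirac p ∈ A} * f p ∂ν := by
  have hg : Measurable fun p => P {ω | N ω + Measure.dirac p ∈ A} :=
    measurable_measure_prodMk_left (measurable_add_dirac hN.measurable hA)
  -- For fixed `A` both sides are integrals of `f` against measures on `E`; these agree on sets of
  -- finite intensity, hence everywhere by exhaustion.
  have h : (P.restrict (N ⁻¹' A)).bind N
      = ν.withDensity fun p => P {ω | N ω + Measure.dirac p ∈ A} := by
    ext B hB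
    have hmono : Monotone fun k => B ∩ spanningSets ν k := fun i j hij =>
      Set.inter_subset_inter_right _ (monotone_spanningSets ν hij)
    have hU : ⋃ k, B ∩ spanningSets ν k = B := by
      rw [← Set.inter_iUnion, iUnion_spanningSets, Set.inter_univ]
    rw [← hU, hmono.measure_iUnion, hmono.measure_iUnion]
    refine iSup_congr fun k => ?_
    have hBk := hB.inter (measurableSet_spanningSets ν k)
    rw [Measure.bind_apply hBk hN.measurable.aemeasurable, withDensity_apply _ hBk]
    exact hN.setLIntegral_apply hA hBk (ne_top_of_le_ne_top (measure_spanningSets_lt_top ν k).ne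
      (measure_mono Set.inter_subset_right))
  rw [← Measure.lintegral_bind hN.measurable.aemeasurable hf.aemeasurable, h,
    lintegral_withDensity_eq_lintegral_mul _ hg hf]
  rfl

end PoissonMecke

lemma PosReal.measurable_toENNReal : Measurable PosReal.toENNReal :=
  ENNReal.measurable_ofReal.comp measurable_subtype_coe

lemma PosReal.toENNReal_ne_zero (s : PosReal) : s.toENNReal ≠ 0 :=
  (ENNReal.ofReal_pos.2 s.2).ne'

lemma PosReal.toENNReal_ne_top (s : PosReal) : s.toENNReal ≠ ∞ := ENNReal.ofReal_ne_top

/-- `ν` has the finite density `f⁻¹` with respect to the finite measure of density `f`. -/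
lemma sigmaFinite_of_lintegral_lt_top {E : Type*} [MeasurableSpace E] {ν : Measure E}
    {f : E → ℝ≥0∞} (hf : Measurable f) (h0 : ∀ x, f x ≠ 0) (htop : ∀ x, f x ≠ ∞)
    (h : ∫⁻ x, f x ∂ν < ∞) : SigmaFinite ν := by
  have : IsFiniteMeasure (ν.withDensity f) := isFiniteMeasure_withDensity h.ne
  rw [← withDensity_inv_same (μ := ν) hf (ae_of_all _ h0) (ae_of_all _ htop)]
  exact SigmaFinite.withDensity_of_ne_top' fun x => ENNReal.inv_ne_top.2 (h0 x)

/-! ### σ-finiteness of the intensity and of its kernel. -/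

section Intensity

lemma measurable_min_one : Measurable fun s : PosReal => min s.toENNReal 1 :=
  PosReal.measurable_toENNReal.min measurable_const

lemma measurableSet_lintegral_min_lt_top {𝕏 : Type*} [MeasurableSpace 𝕏] (ρ : Kernel 𝕏 PosReal) :
    MeasurableSet {y | ∫⁻ s, min s.toENNReal 1 ∂ρ y < ∞} :=
  measurableSet_lt measurable_min_one.lintegral_kernel measurable_const

lemma sigmaFinite_of_lintegral_min_lt_top {m : Measure PosReal}
    (h : ∫⁻ s, min s.toENNReal 1 ∂m < ∞) : SigmaFinite m :=
  sigmaFinite_of_lintegral_lt_top measurable_min_one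
    (fun s => (lt_min (pos_iff_ne_zero.2 s.toENNReal_ne_zero) one_pos).ne')
    (fun _ => ne_top_of_le_ne_top ENNReal.one_ne_top (min_le_right _ _)) h

lemma sigmaFinite_compProd {𝕏 : Type*} [MeasurableSpace 𝕏] {η : Measure 𝕏}
    [IsProbabilityMeasure η] {ρ : Kernel 𝕏 PosReal} [IsSFiniteKernel ρ]
    (h : ∀ y, ∫⁻ s, min s.toENNReal 1 ∂ρ y < ∞) :
    SigmaFinite (η ⊗ₘ ρ) := by
  let I : 𝕏 → ℝ≥0∞ := fun y => ∫⁻ s, min s.toENNReal 1 ∂ρ y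
  have hI : Measurable I := measurable_min_one.lintegral_kernel
  have hI1 : ∀ y, 1 + I y ≠ ∞ := fun y => ENNReal.add_ne_top.2 ⟨ENNReal.one_ne_top, (h y).ne⟩
  -- `I` is finite but may fail to be `η`-integrable; the factor `(1 + I)⁻¹` bounds each inner
  -- integral by `1`.
  have hf : Measurable fun p : 𝕏 × PosReal => (1 + I p.1)⁻¹ * min p.2.toENNReal 1 :=
    ((hI.const_add 1).inv.comp measurable_fst).mul (measurable_min_one.comp measurable_snd)
  refine sigmaFinite_of_lintegral_lt_top hf (fun p => ?_) (fun p => ?_) ?_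
  · exact mul_ne_zero (ENNReal.inv_ne_zero.2 (hI1 _))
      (lt_min (pos_iff_ne_zero.2 p.2.toENNReal_ne_zero) one_pos).ne'
  · exact ENNReal.mul_ne_top (ENNReal.inv_ne_top.2 (by simp))
      (ne_top_of_le_ne_top ENNReal.one_ne_top (min_le_right _ _))
  · rw [Measure.lintegral_compProd hf]
    calc ∫⁻ y, ∫⁻ s, (1 + I y)⁻¹ * min s.toENNReal 1 ∂ρ y ∂η
        ≤ ∫⁻ _, 1 ∂η := lintegral_mono fun y => by
          rw [lintegral_const_mul _ measurable_min_one, mul_comm, ← div_eq_mul_inv]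
          exact ENNReal.div_le_of_le_mul (by simp [I])
      _ < ∞ := by simp

variable {𝕏 : Type*} [MetricSpace 𝕏] [MeasurableSpace 𝕏] [BorelSpace 𝕏]
  {η : Measure 𝕏} [IsProbabilityMeasure η] {ρ : Kernel 𝕏 PosReal} [IsSFiniteKernel ρ]

/-- The integrability condition gives this almost everywhere on each ball, and countably many balls
cover the space. -/
lemma IsCRMIntensity.ae_lintegral_min_lt_top (hν : IsCRMIntensity (η ⊗ₘ ρ)) :
    ∀ᵐ y ∂η, ∫⁻ s, min s.toENNReal 1 ∂ρ y < ∞ := by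
  obtain ⟨x₀⟩ : Nonempty 𝕏 := nonempty_of_isProbabilityMeasure η
  have h : ∀ k : ℕ, ∀ᵐ y ∂η, y ∈ Metric.ball x₀ k → ∫⁻ s, min s.toENNReal 1 ∂ρ y < ∞ := by
    intro k
    have hk := hν (Metric.ball x₀ k) measurableSet_ball Metric.isBounded_ball 1 one_pos
    rw [ENNReal.ofReal_one, Measure.setLIntegral_compProd
      (f := fun p : 𝕏 × PosReal => min p.2.toENNReal 1) (measurable_min_one.comp measurable_snd)
      measurableSet_ball .univ] at hk
    simp only [Measure.restrict_univ] at hk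
    rw [← ae_restrict_iff' measurableSet_ball]
    exact ae_lt_top (measurable_min_one.lintegral_kernel) hk.ne
  filter_upwards [ae_all_iff.2 h] with y hy
  obtain ⟨k, hk⟩ := exists_nat_gt (dist y x₀)
  exact hy k hk

/-- There is a version of the Lévy kernel all of whose values integrate `min (s, 1)`. -/
lemma IsCRMIntensity.exists_kernel (hν : IsCRMIntensity (η ⊗ₘ ρ)) :
    ∃ ρ' : Kernel 𝕏 PosReal, IsSFiniteKernel ρ' ∧ (∀ᵐ y ∂η, ρ' y = ρ y) ∧
      ∀ y, ∫⁻ s, min s.toENNReal 1 ∂ρ' y < ∞ := by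
  classical
  -- The kernel is set to zero on the exceptional null set, so that σ-finiteness holds at every
  -- point, as product measures of jumps at arbitrary sample values need.
  refine ⟨Kernel.piecewise (measurableSet_lintegral_min_lt_top ρ) ρ 0, inferInstance, ?_, ?_⟩
  · filter_upwards [hν.ae_lintegral_min_lt_top] with y hy
    rw [Kernel.piecewise_apply]
    exact if_pos hy
  · intro y
    rw [Kernel.piecewise_apply]
    split_ifs with hy
    · exact hy
    · simp

end Intensity

/-! ### The Mecke formula transferred to completely random measures. -/

section CRM

variable {𝕏 : Type*} [MeasurableSpace 𝕏]

lemma crmOf_apply (N : Measure (𝕏 × PosReal)) {B : Set 𝕏} (hB : MeasurableSet B) :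
    crmOf N B = ∫⁻ p, B.indicator 1 p.1 * p.2.toENNReal ∂N := by
  rw [crmOf, Measure.map_apply measurable_fst hB, withDensity_apply _ (measurable_fst hB),
    ← lintegral_indicator (measurable_fst hB)]
  refine lintegral_congr fun p => ?_
  by_cases h : p.1 ∈ B <;> simp [h]

lemma measurable_indicator_mul_jump {B : Set 𝕏} (hB : MeasurableSet B) :
    Measurable fun p : 𝕏 × PosReal => B.indicator (1 : 𝕏 → ℝ≥0∞) p.1 * p.2.toENNReal :=
  ((measurable_one.indicator hB).comp measurable_fst).mul
    (PosReal.measurable_toENNReal.comp measurable_snd)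

lemma measurable_crmOf : Measurable (crmOf : Measure (𝕏 × PosReal) → Measure 𝕏) :=
  Measure.measurable_of_measurable_coe _ fun B hB => by
    simp only [crmOf_apply _ hB]
    exact Measure.measurable_lintegral (measurable_indicator_mul_jump hB)

lemma crmOf_add_dirac (N : Measure (𝕏 × PosReal)) (p : 𝕏 × PosReal) :
    crmOf (N + Measure.dirac p) = crmOf N + p.2.toENNReal • Measure.dirac p.1 := by
  ext B hB
  rw [crmOf_apply _ hB, lintegral_add_measure,
    lintegral_dirac' _ (measurable_indicator_mul_jump hB), ← crmOf_apply _ hB, Measure.add_apply,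
    Measure.smul_apply, Measure.dirac_apply' _ hB, smul_eq_mul, mul_comm]

lemma measurable_add_smul_dirac {α : Type*} [MeasurableSpace α] {f : α → Measure 𝕏}
    {s : α → ℝ≥0∞} {z : α → 𝕏} (hf : Measurable f) (hs : Measurable s) (hz : Measurable z) :
    Measurable fun a => f a + s a • Measure.dirac (z a) :=
  Measure.measurable_of_measurable_coe _ fun B hB => by
    simp only [Measure.add_apply, Measure.smul_apply, smul_eq_mul]
    exact ((Measure.measurable_coe hB).comp hf).add
      (hs.mul ((Measure.measurable_coe hB).comp (Measure.measurable_dirac.comp hz)))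

/-- The Mecke formula for completely random measures. -/
theorem lintegral_mul_apply_crm {η : Measure 𝕏} [IsProbabilityMeasure η] {ρ : Kernel 𝕏 PosReal}
    [IsSFiniteKernel ρ] [SigmaFinite (η ⊗ₘ ρ)]
    {Ω : Type*} [MeasurableSpace Ω] {P : Measure Ω} [IsProbabilityMeasure P]
    {N : Ω → Measure (𝕏 × PosReal)} (hN : IsPoissonProcess N (η ⊗ₘ ρ) P)
    {g : Measure 𝕏 → ℝ≥0∞} (hg : Measurable g) {B : Set 𝕏} (hB : MeasurableSet B) :
    ∫⁻ m, g m * m B ∂P.map (fun ω => crmOf (N ω))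
      = ∫⁻ z in B, ∫⁻ s, s.toENNReal *
          ∫⁻ m, g (m + s.toENNReal • Measure.dirac z) ∂P.map (fun ω => crmOf (N ω)) ∂ρ z ∂η := by
  set Q := P.map fun ω => crmOf (N ω) with hQ
  have hμ : Measurable fun ω => crmOf (N ω) := measurable_crmOf.comp hN.measurable
  have : IsProbabilityMeasure Q := Measure.isProbabilityMeasure_map hμ.aemeasurable
  have hw := measurable_indicator_mul_jump hB
  let w : 𝕏 × PosReal → ℝ≥0∞ := fun p => B.indicator (1 : 𝕏 → ℝ≥0∞) p.1 * p.2.toENNReal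
  have hadd : Measurable fun q : (𝕏 × PosReal) × Measure 𝕏 =>
      q.2 + q.1.2.toENNReal • Measure.dirac q.1.1 :=
    measurable_add_smul_dirac measurable_snd
      (PosReal.measurable_toENNReal.comp (measurable_snd.comp measurable_fst))
      (measurable_fst.comp measurable_fst)
  have hgadd : Measurable fun p : 𝕏 × PosReal =>
      ∫⁻ m, g (m + p.2.toENNReal • Measure.dirac p.1) ∂Q :=
    (hg.comp hadd).lintegral_prod_right'
  -- The case where `g` is an indicator, stated as an equality of measures. An added Poisson point
  -- `(z, s)` changes the random measure by `s δ_z`, and integrating over such points with weight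
  -- `1_B(z) s` gives the mass of `B`.
  have key : Q.withDensity (fun m => m B)
      = (((η ⊗ₘ ρ).withDensity w).prod Q).map
          fun q => q.2 + q.1.2.toENNReal • Measure.dirac q.1.1 := by
    ext A hA
    rw [withDensity_apply _ hA, hQ, setLIntegral_map hA (Measure.measurable_coe hB) hμ,
      Measure.map_apply hadd hA, Measure.prod_apply (hadd hA),
      lintegral_withDensity_eq_lintegral_mul _ hw (measurable_measure_prodMk_left (hadd hA))]
    simp only [crmOf_apply _ hB]
    refine (hN.mecke (measurable_crmOf hA) hw).trans (lintegral_congr fun p => ?_)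
    rw [mul_comm, Pi.mul_apply, Measure.map_apply hμ (measurable_prodMk_left (hadd hA))]
    simp only [Set.mem_preimage, crmOf_add_dirac]
    rfl
  have h1 := lintegral_withDensity_eq_lintegral_mul Q (Measure.measurable_coe hB) hg
  simp only [Pi.mul_apply, mul_comm _ (g _)] at h1
  rw [← h1, key, lintegral_map hg hadd, lintegral_prod
      (fun q : (𝕏 × PosReal) × Measure 𝕏 => g (q.2 + q.1.2.toENNReal • Measure.dirac q.1.1))
      (hg.comp hadd).aemeasurable,
    lintegral_withDensity_eq_lintegral_mul _ hw hgadd, Measure.lintegral_compProd (hw.mul hgadd),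
    ← lintegral_indicator hB]
  refine lintegral_congr fun z => ?_
  by_cases hz : z ∈ B <;> simp [hz]

end CRM

/-! ### Integrals over independent jumps at finitely many fixed locations. -/

section JumpIntegral

variable {𝕏 : Type*} [MeasurableSpace 𝕏] {j : 𝕏 → ℕ → Measure PosReal}

/-- The integral of `g (μ₀ + ∑ s_y δ_y)`, summing over `y ∈ D`, against the product of the measures
`j y (m y)` in the jump sizes `s_y`. -/
def jumpIntegral (j : 𝕏 → ℕ → Measure PosReal) (D : Finset 𝕏) (m : 𝕏 → ℕ)
    (g : Measure 𝕏 → ℝ≥0∞) (μ₀ : Measure 𝕏) : ℝ≥0∞ :=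
  ∫⁻ w : ↥D → PosReal, g (μ₀ + ∑ y : ↥D, (w y).toENNReal • Measure.dirac (y : 𝕏))
    ∂Measure.pi fun y : ↥D => j y (m y)

lemma measurable_add_sum_smul_dirac {ι α : Type*} [MeasurableSpace α] (D : Finset ι)
    {f : α → Measure 𝕏} {s : ι → α → ℝ≥0∞} {z : ι → 𝕏} (hf : Measurable f)
    (hs : ∀ i, Measurable (s i)) :
    Measurable fun a => f a + ∑ i ∈ D, s i a • Measure.dirac (z i) :=
  Measure.measurable_of_measurable_coe _ fun B hB => by
    simp only [Measure.add_apply, Measure.finsetSum_apply, Measure.smul_apply, smul_eq_mul]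
    exact ((Measure.measurable_coe hB).comp hf).add
      (Finset.measurable_sum _ fun i _ => (hs i).mul_const _)

lemma measurable_addJumps (D : Finset 𝕏) :
    Measurable fun p : Measure 𝕏 × (↥D → PosReal) =>
      p.1 + ∑ y : ↥D, (p.2 y).toENNReal • Measure.dirac (y : 𝕏) :=
  measurable_add_sum_smul_dirac _ measurable_fst fun y =>
    PosReal.measurable_toENNReal.comp ((measurable_pi_apply y).comp measurable_snd)

lemma jumpIntegral_congr {D : Finset 𝕏} {m m' : 𝕏 → ℕ} (h : ∀ y ∈ D, m y = m' y)
    (g : Measure 𝕏 → ℝ≥0∞) (μ₀ : Measure 𝕏) :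
    jumpIntegral j D m g μ₀ = jumpIntegral j D m' g μ₀ := by
  unfold jumpIntegral
  congr 2
  funext y
  rw [h y y.2]

variable [∀ y k, SigmaFinite (j y k)] {g : Measure 𝕏 → ℝ≥0∞}

lemma measurable_jumpIntegral (D : Finset 𝕏) (m : 𝕏 → ℕ) (hg : Measurable g) :
    Measurable (jumpIntegral j D m g) :=
  (hg.comp (measurable_addJumps D)).lintegral_prod_right'

lemma lintegral_addJumpsLaw {Q : Measure (Measure 𝕏)} {n : ℕ}
    (x : Fin n → 𝕏) (hg : Measurable g) :
    ∫⁻ μ, g μ ∂addJumpsLaw Q j x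
      = ∫⁻ μ₀, jumpIntegral j (distinctValues x) (multiplicity x) g μ₀ ∂Q := by
  rw [addJumpsLaw, lintegral_map hg (measurable_addJumps _)]
  exact lintegral_prod _ (hg.comp (measurable_addJumps _)).aemeasurable

omit [∀ y k, SigmaFinite (j y k)] in
lemma jumpIntegral_empty (m : 𝕏 → ℕ) (g : Measure 𝕏 → ℝ≥0∞) (μ₀ : Measure 𝕏) :
    jumpIntegral j ∅ m g μ₀ = g μ₀ := by
  simp [jumpIntegral, Measure.pi_of_empty (fun y : (∅ : Finset 𝕏) => j y (m y))]

lemma jumpIntegral_insert [DecidableEq 𝕏] {D : Finset 𝕏} (m : 𝕏 → ℕ) (hg : Measurable g)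
    (μ₀ : Measure 𝕏) {z : 𝕏} (hz : z ∉ D) :
    jumpIntegral j (insert z D) m g μ₀
      = ∫⁻ s, jumpIntegral j D m g (μ₀ + s.toENNReal • Measure.dirac z) ∂j z (m z) := by
  -- An arbitrary base point: `f` reads only the coordinates that `lmarginal` overwrites.
  let w₀ : 𝕏 → PosReal := fun _ => ⟨1, Set.mem_Ioi.2 one_pos⟩
  let f : (𝕏 → PosReal) → ℝ≥0∞ := fun w =>
    g (μ₀ + ∑ y ∈ insert z D, (w y).toENNReal • Measure.dirac y)
  have hf : Measurable f := hg.comp (measurable_add_sum_smul_dirac _ measurable_const fun y =>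
    PosReal.measurable_toENNReal.comp (measurable_pi_apply y))
  have h1 : jumpIntegral j (insert z D) m g μ₀
      = lmarginal (fun y => j y (m y)) (insert z D) f w₀ := by
    unfold jumpIntegral lmarginal
    refine lintegral_congr fun w => ?_
    simp only [f]
    rw [← Finset.sum_coe_sort (insert z D)]
    congr 2
    refine Finset.sum_congr rfl fun y _ => ?_
    rw [Function.updateFinset, dif_pos y.2]
  rw [h1, lmarginal_insert f hf hz]
  refine lintegral_congr fun s => ?_
  unfold jumpIntegral lmarginal
  refine lintegral_congr fun w => ?_
  simp only [f]
  rw [Finset.sum_insert hz, ← Finset.sum_coe_sort D, ← add_assoc]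
  simp [Function.updateFinset, hz]

/-- Here the jump at `z` is integrated innermost, so it can be absorbed into the integrand, leaving
only the locations in `D`. -/
lemma jumpIntegral_lintegral [DecidableEq 𝕏] {D : Finset 𝕏} (m : 𝕏 → ℕ) (hg : Measurable g)
    (μ₀ : Measure 𝕏) {z : 𝕏} (hz : z ∉ D) :
    jumpIntegral j (insert z D) m g μ₀
      = jumpIntegral j D m
          (fun μ => ∫⁻ s, g (μ + s.toENNReal • Measure.dirac z) ∂j z (m z)) μ₀ := by
  have hmeas : Measurable fun q : PosReal × (↥D → PosReal) =>
      μ₀ + q.1.toENNReal • Measure.dirac z +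
        ∑ y : ↥D, (q.2 y).toENNReal • Measure.dirac (y : 𝕏) :=
    (measurable_addJumps D).comp ((measurable_add_smul_dirac measurable_const
      (PosReal.measurable_toENNReal.comp measurable_fst) measurable_const).prodMk measurable_snd)
  rw [jumpIntegral_insert m hg μ₀ hz]
  unfold jumpIntegral
  refine (lintegral_lintegral_swap 
    (f := fun (s : PosReal) (w : ↥D → PosReal) => g (μ₀ + s.toENNReal • Measure.dirac z +
    ∑ y : ↥D, (w y).toENNReal • Measure.dirac (y : 𝕏))) (hg.comp hmeas).aemeasurable).trans ?_
  simp only [add_right_comm]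

/-- At `μ = μ₀ + ∑ s_y δ_y` one has `μ B = μ₀ B + ∑ 1_B(y) s_y`, and by `hj` a factor `s_y` raises
the index of the jump measure at `y` by one. -/
lemma jumpIntegral_mul_apply [DecidableEq 𝕏]
    (hj : ∀ y k, j y (k + 1) = (j y k).withDensity PosReal.toENNReal)
    (D : Finset 𝕏) (m : 𝕏 → ℕ) (hg : Measurable g) {B : Set 𝕏} (hB : MeasurableSet B)
    (μ₀ : Measure 𝕏) :
    jumpIntegral j D m (fun μ => g μ * μ B) μ₀
      = jumpIntegral j D m g μ₀ * μ₀ B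
        + ∑ y ∈ D, B.indicator 1 y * jumpIntegral j D (m + Pi.single y 1) g μ₀ := by
  have hgB : Measurable fun μ => g μ * μ B := hg.mul (Measure.measurable_coe hB)
  induction D using Finset.induction generalizing μ₀ with
  | empty => simp [jumpIntegral_empty]
  | insert z D hz ih =>
    have hadd : Measurable fun s : PosReal => μ₀ + s.toENNReal • Measure.dirac z :=
      measurable_add_smul_dirac measurable_const PosReal.measurable_toENNReal measurable_const
    have hJ : ∀ m' : 𝕏 → ℕ, Measurable fun s : PosReal =>
        jumpIntegral j D m' g (μ₀ + s.toENNReal • Measure.dirac z) := fun m' =>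
      (measurable_jumpIntegral D m' hg).comp hadd
    have hz1 : jumpIntegral j (insert z D) (m + Pi.single z 1) g μ₀
        = ∫⁻ s, s.toENNReal * jumpIntegral j D m g (μ₀ + s.toENNReal • Measure.dirac z)
            ∂j z (m z) := by
      rw [jumpIntegral_insert _ hg μ₀ hz]
      simp only [Pi.add_apply, Pi.single_eq_same]
      rw [hj, lintegral_withDensity_eq_lintegral_mul _ PosReal.measurable_toENNReal (hJ _)]
      refine lintegral_congr fun s => ?_
      rw [Pi.mul_apply, jumpIntegral_congr (m' := m)]
      intro y hy
      have : y ≠ z := fun h => hz (h ▸ hy)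
      simp [this]
    have hy1 : ∀ y ∈ D, jumpIntegral j (insert z D) (m + Pi.single y 1) g μ₀
        = ∫⁻ s, jumpIntegral j D (m + Pi.single y 1) g (μ₀ + s.toENNReal • Measure.dirac z)
            ∂j z (m z) := fun y hy => by
      have : z ≠ y := fun h => hz (h ▸ hy)
      rw [jumpIntegral_insert _ hg μ₀ hz]
      simp [this]
    rw [jumpIntegral_insert m hgB μ₀ hz, Finset.sum_insert hz, hz1,
      jumpIntegral_insert m hg μ₀ hz]
    simp only [ih]
    have hB1 : (Measure.dirac z) B = B.indicator 1 z := Measure.dirac_apply' _ hB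
    simp only [Measure.add_apply, Measure.smul_apply, smul_eq_mul, hB1, mul_add]
    have hmul : Measurable fun s : PosReal =>
        jumpIntegral j D m g (μ₀ + s.toENNReal • Measure.dirac z) *
          (s.toENNReal * B.indicator 1 z) :=
      (hJ m).mul (PosReal.measurable_toENNReal.mul_const _)
    simp only [add_assoc]
    rw [lintegral_add_left ((hJ m).mul_const _), lintegral_add_left hmul,
      lintegral_mul_const _ (hJ m), lintegral_finsetSum _ fun y _ => (hJ _).const_mul _]
    congr 2
    · have hmul' : Measurable fun s : PosReal =>
          s.toENNReal * jumpIntegral j D m g (μ₀ + s.toENNReal • Measure.dirac z) :=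
        PosReal.measurable_toENNReal.mul (hJ m)
      rw [← lintegral_const_mul _ hmul']
      exact lintegral_congr fun s => by ring
    · refine Finset.sum_congr rfl fun y hy => ?_
      rw [lintegral_const_mul _ (hJ _), hy1 y hy]

end JumpIntegral

/-! ### Distinct values, multiplicities and the reference measure on samples. -/

section Samples

variable {𝕏 : Type*}

open scoped Classical in
lemma distinctValues_cons {n : ℕ} (z : 𝕏) (x : Fin n → 𝕏) :
    distinctValues (Fin.cons z x : Fin (n + 1) → 𝕏) = insert z (distinctValues x) := by
  ext y
  simp [distinctValues, Fin.exists_fin_succ, eq_comm]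

lemma mem_distinctValues {n : ℕ} (x : Fin n → 𝕏) {y : 𝕏} :
    y ∈ distinctValues x ↔ ∃ i, x i = y := by
  classical
  simp [distinctValues]

lemma multiplicity_eq_zero {n : ℕ} {x : Fin n → 𝕏} {y : 𝕏} (hy : y ∉ distinctValues x) :
    multiplicity x y = 0 := by
  classical
  simpa [multiplicity, distinctValues, Finset.filter_eq_empty_iff] using hy

open scoped Classical in
lemma multiplicity_cons {n : ℕ} (z : 𝕏) (x : Fin n → 𝕏) :
    multiplicity (Fin.cons z x : Fin (n + 1) → 𝕏) = multiplicity x + Pi.single z 1 := by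
  funext y
  simp only [multiplicity, Finset.card_filter, Fin.sum_univ_succ, Fin.cons_zero, Fin.cons_succ,
    Pi.add_apply, Pi.single_apply, eq_comm (a := z)]
  rw [add_comm]

open scoped Classical in
-- Indexing each distinct value by its first occurrence turns a sum over a set depending on `x` into
-- one over a fixed index set, whose terms can be checked to be measurable in `x`.
lemma sum_distinctValues {M : Type*} [AddCommMonoid M] {n : ℕ} (x : Fin n → 𝕏) (f : 𝕏 → M) :
    ∑ y ∈ distinctValues x, f y
      = ∑ i : Fin n, if ∀ k < i, x k ≠ x i then f (x i) else 0 := by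
  have himg : distinctValues x
      = (Finset.univ.filter fun i : Fin n => ∀ k < i, x k ≠ x i).image x := by
    refine (Finset.Subset.antisymm ?_ (Finset.image_subset_image (Finset.filter_subset _ _)))
    intro y hy
    obtain ⟨i, -, rfl⟩ := Finset.mem_image.1 hy
    -- Descent to the first occurrence: if `i` is not first, some smaller index carries the same
    -- value.
    induction i using WellFoundedLT.induction with
    | ind i ih =>
      by_cases h : ∀ k < i, x k ≠ x i
      · exact Finset.mem_image.2 ⟨i, by simpa using h, rfl⟩
      · push Not at h
        obtain ⟨k, hk, hki⟩ := h
        rw [← hki]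
        exact ih k hk (Finset.mem_image_of_mem x (Finset.mem_univ k))
  rw [himg, Finset.sum_image, Finset.sum_filter]
  intro i hi k hk hik
  simp only [Finset.coe_filter, Finset.mem_univ, true_and, Set.mem_ofPred_eq] at hi hk
  rcases lt_trichotomy i k with h | h | h
  · exact absurd hik (hk i h)
  · exact h
  · exact absurd hik.symm (hi k h)

variable [MeasurableSpace 𝕏]

lemma measurable_cons {α : Type*} [MeasurableSpace α] {n : ℕ} {z : α → 𝕏} {x : α → Fin n → 𝕏}
    (hz : Measurable z) (hx : Measurable x) :
    Measurable fun a => (Fin.cons (z a) (x a) : Fin (n + 1) → 𝕏) :=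
  measurable_pi_iff.2 fun i => by
    refine Fin.cases ?_ (fun i => ?_) i
    · simpa using hz
    · simpa [Function.comp_def] using (measurable_pi_apply i).comp hx

lemma measurable_cons_self {n : ℕ} (i : Fin n) :
    Measurable fun x : Fin n → 𝕏 => (Fin.cons (x i) x : Fin (n + 1) → 𝕏) :=
  measurable_cons (measurable_pi_apply i) measurable_id

/-- The measure on samples under which each observation is either a new draw from `η` or a copy of
one of the distinct values among the later ones, with unit weight for each of these options. It is
the sum over the partitions of the index set of the laws of the samples whose values on the blocks
are independent draws from `η`. -/
def partitionMeasure (η : Measure 𝕏) : ∀ n, Measure (Fin n → 𝕏)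
  | 0 => Measure.dirac Fin.elim0
  | n + 1 => ((partitionMeasure η n).prod η).map (fun p => Fin.cons p.2 p.1) +
      ∑ i : Fin n, ((partitionMeasure η n).restrict {x | ∀ k < i, x k ≠ x i}).map
        fun x => Fin.cons (x i) x

instance isFiniteMeasure_partitionMeasure (η : Measure 𝕏) [IsFiniteMeasure η] (n : ℕ) :
    IsFiniteMeasure (partitionMeasure η n) := by
  induction n with
  | zero => unfold partitionMeasure; infer_instance
  | succ n ih => unfold partitionMeasure; infer_instance

lemma ae_partitionMeasure {η : Measure 𝕏} [IsFiniteMeasure η] {p : 𝕏 → Prop}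
    (hp : ∀ᵐ y ∂η, p y) (n : ℕ) : ∀ᵐ x ∂partitionMeasure η n, ∀ i, p (x i) := by
  -- The exceptional set is enlarged to a measurable null set, since almost-everywhere statements
  -- are pulled back through maps below.
  obtain ⟨t, htp, ht, hη⟩ := exists_measurable_superset_of_null (ae_iff.1 hp)
  suffices h : ∀ᵐ x ∂partitionMeasure η n, ∀ i, x i ∈ tᶜ by
    filter_upwards [h] with x hx i
    by_contra hi
    exact hx i (htp hi)
  have hmeas : ∀ n, MeasurableSet {x : Fin n → 𝕏 | ∀ i, x i ∈ tᶜ} := fun n => by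
    simp only [Set.ofPred_forall]
    exact MeasurableSet.iInter fun i => measurable_pi_apply i ht.compl
  have htη : ∀ᵐ y ∂η, y ∈ tᶜ := measure_eq_zero_iff_ae_notMem.1 hη
  induction n with
  | zero => exact ae_of_all _ fun x i => i.elim0
  | succ n ih =>
    rw [partitionMeasure, ae_add_measure_iff]
    constructor
    · rw [ae_map_iff (measurable_cons measurable_snd measurable_fst).aemeasurable (hmeas _)]
      have h1 := Measure.quasiMeasurePreserving_fst (μ := partitionMeasure η n) (ν := η) |>.ae ih
      have h2 := Measure.quasiMeasurePreserving_snd (μ := partitionMeasure η n) (ν := η) |>.ae htη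
      filter_upwards [h1, h2] with q hq1 hq2 i
      refine Fin.cases ?_ (fun i => ?_) i
      · simpa using hq2
      · simpa using hq1 i
    · rw [← Measure.sum_fintype, Measure.ae_sum_iff]
      intro i
      rw [ae_map_iff (measurable_cons_self i).aemeasurable (hmeas _)]
      filter_upwards [ae_restrict_of_ae ih] with x hx k
      refine Fin.cases ?_ (fun k => ?_) k
      · simpa using hx i
      · simpa using hx k

variable [MeasurableEq 𝕏]

lemma measurableSet_first {n : ℕ} (i : Fin n) :
    MeasurableSet {x : Fin n → 𝕏 | ∀ k < i, x k ≠ x i} := by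
  simp only [Set.ofPred_forall]
  refine MeasurableSet.iInter fun k => MeasurableSet.iInter fun _ => ?_
  exact (measurableSet_eq_fun (measurable_pi_apply k) (measurable_pi_apply i)).compl

/-- Prepending an observation means integrating over a fresh draw and summing over copies of the
distinct values; this is the recursion that the one-point Mecke formula reproduces. -/
lemma lintegral_partitionMeasure_succ {η : Measure 𝕏} [IsFiniteMeasure η] {n : ℕ}
    {H : (Fin (n + 1) → 𝕏) → ℝ≥0∞} (hH : Measurable H) :
    ∫⁻ x, H x ∂partitionMeasure η (n + 1)
      = ∫⁻ x, (∫⁻ z, H (Fin.cons z x) ∂η + ∑ y ∈ distinctValues x, H (Fin.cons y x))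
          ∂partitionMeasure η n := by
  classical
  have hcons : Measurable fun p : (Fin n → 𝕏) × 𝕏 => (Fin.cons p.2 p.1 : Fin (n + 1) → 𝕏) :=
    measurable_cons measurable_snd measurable_fst
  have hHc : Measurable fun p : (Fin n → 𝕏) × 𝕏 => H (Fin.cons p.2 p.1) := hH.comp hcons
  rw [lintegral_add_left hHc.lintegral_prod_right', partitionMeasure, lintegral_add_measure,
    lintegral_map hH hcons, lintegral_prod _ hHc.aemeasurable, lintegral_finsetSum_measure]
  congr 1
  simp only [sum_distinctValues _ fun y => H (Fin.cons y _)]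
  rw [lintegral_finsetSum]
  · refine Finset.sum_congr rfl fun i _ => ?_
    rw [lintegral_map hH (measurable_cons_self i), ← lintegral_indicator (measurableSet_first i)]
    simp only [Set.indicator_apply, Set.mem_ofPred_eq]
  · exact fun i _ => Measurable.ite (measurableSet_first i) (hH.comp (measurable_cons_self i)) measurable_const

lemma measurable_multiplicity {n : ℕ} (i : Fin n) :
    Measurable fun x : Fin n → 𝕏 => multiplicity x (x i) := by
  classical
  simp only [multiplicity, Finset.card_filter]
  refine Finset.measurable_sum _ fun k _ => Measurable.ite ?_ measurable_const measurable_const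
  exact measurableSet_eq_fun (measurable_pi_apply k) (measurable_pi_apply i)

end Samples

/-! ### The multivariate Mecke formula. -/

section MultivariateMecke

variable {𝕏 : Type*} [MeasurableSpace 𝕏] {ρ : Kernel 𝕏 PosReal}

instance sigmaFinite_jumpMeasure [∀ y, SigmaFinite (ρ y)] (y : 𝕏) (m : ℕ) :
    SigmaFinite (jumpMeasure ρ y m) :=
  SigmaFinite.withDensity_of_ne_top' fun s => ENNReal.pow_ne_top s.toENNReal_ne_top

lemma lintegral_jumpMeasure (y : 𝕏) (m : ℕ) {f : PosReal → ℝ≥0∞} (hf : Measurable f) :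
    ∫⁻ s, f s ∂jumpMeasure ρ y m = ∫⁻ s, s.toENNReal ^ m * f s ∂ρ y :=
  lintegral_withDensity_eq_lintegral_mul _ (PosReal.measurable_toENNReal.pow_const m) hf

lemma jumpMeasure_succ (y : 𝕏) (m : ℕ) :
    jumpMeasure ρ y (m + 1) = (jumpMeasure ρ y m).withDensity PosReal.toENNReal := by
  unfold jumpMeasure
  rw [← withDensity_mul _ (PosReal.measurable_toENNReal.pow_const m)
    PosReal.measurable_toENNReal]
  congr 1

variable [∀ y, SigmaFinite (ρ y)] {Q : Measure (Measure 𝕏)}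

section Measurability

variable [MeasurableEq 𝕏] [IsSFiniteKernel ρ] [SFinite Q]

open scoped Classical in
-- The space of jump sizes varies with `x`, so joint measurability is not immediate. The induction
-- adds sample indices one at a time; `F` may depend on `x` so that it can absorb the jumps already
-- integrated out.
lemma measurable_lintegral_jumpIntegral_image {n : ℕ} (S : Finset (Fin n))
    {F : (Fin n → 𝕏) → Measure 𝕏 → ℝ≥0∞} (hF : Measurable (Function.uncurry F)) :
    Measurable fun x : Fin n → 𝕏 =>
      ∫⁻ μ₀, jumpIntegral (jumpMeasure ρ) (S.image x) (multiplicity x) (F x) μ₀ ∂Q := by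
  induction S using Finset.induction generalizing F with
  | empty =>
    simp only [Finset.image_empty, jumpIntegral_empty]
    exact hF.lintegral_prod_right'
  | insert i S hi ih =>
    let F' : (Fin n → 𝕏) → Measure 𝕏 → ℝ≥0∞ := fun x μ =>
      ∫⁻ s, s.toENNReal ^ multiplicity x (x i) * F x (μ + s.toENNReal • Measure.dirac (x i))
        ∂ρ (x i)
    have hF' : Measurable (Function.uncurry F') := by
      have hm : Measurable fun q : ((Fin n → 𝕏) × Measure 𝕏) × PosReal =>
          q.2.toENNReal ^ multiplicity q.1.1 (q.1.1 i) *
            F q.1.1 (q.1.2 + q.2.toENNReal • Measure.dirac (q.1.1 i)) := by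
        have hs : Measurable fun q : ((Fin n → 𝕏) × Measure 𝕏) × PosReal => q.2.toENNReal :=
          PosReal.measurable_toENNReal.comp measurable_snd
        have hx : Measurable fun q : ((Fin n → 𝕏) × Measure 𝕏) × PosReal => q.1.1 :=
          measurable_fst.comp measurable_fst
        refine (hs.pow ((measurable_multiplicity i).comp hx)).mul ?_
        exact hF.comp (hx.prodMk (measurable_add_smul_dirac
          (measurable_snd.comp measurable_fst) hs ((measurable_pi_apply i).comp hx)))
      exact hm.lintegral_kernel_prod_right' (κ := ρ.comap
        (fun p : (Fin n → 𝕏) × Measure 𝕏 => p.1 i) ((measurable_pi_apply i).comp measurable_fst))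
    have hset : MeasurableSet {x : Fin n → 𝕏 | ∃ k ∈ S, x k = x i} := by
      have : {x : Fin n → 𝕏 | ∃ k ∈ S, x k = x i} = ⋃ k ∈ S, {x : Fin n → 𝕏 | x k = x i} := by
        ext; simp
      rw [this]
      exact S.measurableSet_biUnion fun k _ =>
        measurableSet_eq_fun (measurable_pi_apply k) (measurable_pi_apply i)
    -- Either the value `x i` already occurs among the indices in `S`, and nothing changes, or it
    -- brings a new jump, which `F'` integrates out.
    convert @Measurable.ite _ _ _ _ _ _ _ (Classical.decPred _) hset (ih hF) (ih hF') using 2 with x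
    rw [Finset.image_insert]
    split_ifs with h
    · rw [Finset.insert_eq_of_mem (by simpa using h)]
    · refine lintegral_congr fun μ₀ => ?_
      have hFx : Measurable (F x) := hF.comp measurable_prodMk_left
      rw [jumpIntegral_lintegral _ hFx _ (by simpa using h)]
      congr 1
      funext μ
      exact lintegral_jumpMeasure _ _ (hFx.comp (measurable_add_smul_dirac measurable_const
        PosReal.measurable_toENNReal measurable_const))

lemma measurable_lintegral_addJumpsLaw {n : ℕ} {g : Measure 𝕏 → ℝ≥0∞} (hg : Measurable g) :
    Measurable fun x : Fin n → 𝕏 => ∫⁻ μ, g μ ∂addJumpsLaw Q (jumpMeasure ρ) x := by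
  simp only [lintegral_addJumpsLaw _ hg]
  exact measurable_lintegral_jumpIntegral_image Finset.univ (F := fun _ => g)
    (hg.comp measurable_snd)

end Measurability

/-- The Mecke formula for the law `Q` of a completely random measure with intensity
`η(dz) ρ_z(ds)`. -/
def MeckeFormula (Q : Measure (Measure 𝕏)) (η : Measure 𝕏) (ρ : Kernel 𝕏 PosReal) : Prop :=
  ∀ g : Measure 𝕏 → ℝ≥0∞, Measurable g → ∀ B : Set 𝕏, MeasurableSet B →
    ∫⁻ μ, g μ * μ B ∂Q
      = ∫⁻ z in B, ∫⁻ s, s.toENNReal *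
          ∫⁻ μ, g (μ + s.toENNReal • Measure.dirac z) ∂Q ∂ρ z ∂η

variable {η : Measure 𝕏} [SFinite Q]

/-- A fresh value has multiplicity one, so its jump carries the single weight `s` that appears on
the right of the one-point Mecke formula. -/
lemma lintegral_addJumpsLaw_cons {n : ℕ} (x : Fin n → 𝕏) {z : 𝕏} (hz : z ∉ distinctValues x)
    {g : Measure 𝕏 → ℝ≥0∞} (hg : Measurable g) :
    ∫⁻ μ, g μ ∂addJumpsLaw Q (jumpMeasure ρ) (Fin.cons z x : Fin (n + 1) → 𝕏)
      = ∫⁻ s, s.toENNReal * ∫⁻ μ₀, jumpIntegral (jumpMeasure ρ) (distinctValues x)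
          (multiplicity x) g (μ₀ + s.toENNReal • Measure.dirac z) ∂Q ∂ρ z := by
  classical
  have hm : ∀ y ∈ distinctValues x,
      (multiplicity x + Pi.single z 1 : 𝕏 → ℕ) y = multiplicity x y := fun y hy => by
    have : y ≠ z := fun h => hz (h ▸ hy)
    simp [this]
  have hJ : Measurable fun q : Measure 𝕏 × PosReal =>
      jumpIntegral (jumpMeasure ρ) (distinctValues x) (multiplicity x) g
        (q.1 + q.2.toENNReal • Measure.dirac z) :=
    (measurable_jumpIntegral _ _ hg).comp (measurable_add_smul_dirac measurable_fst
      (PosReal.measurable_toENNReal.comp measurable_snd) measurable_const)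
  have hJs : ∀ μ₀ : Measure 𝕏, Measurable fun s : PosReal =>
      jumpIntegral (jumpMeasure ρ) (distinctValues x) (multiplicity x) g
        (μ₀ + s.toENNReal • Measure.dirac z) := fun μ₀ => hJ.comp measurable_prodMk_left
  have hJm : ∀ s : PosReal, Measurable fun μ₀ : Measure 𝕏 =>
      jumpIntegral (jumpMeasure ρ) (distinctValues x) (multiplicity x) g
        (μ₀ + s.toENNReal • Measure.dirac z) := fun s => hJ.comp measurable_prodMk_right
  have hsJ : Measurable fun q : Measure 𝕏 × PosReal => q.2.toENNReal *
      jumpIntegral (jumpMeasure ρ) (distinctValues x) (multiplicity x) g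
        (q.1 + q.2.toENNReal • Measure.dirac z) :=
    (PosReal.measurable_toENNReal.comp measurable_snd).mul hJ
  rw [lintegral_addJumpsLaw _ hg, distinctValues_cons, multiplicity_cons]
  simp only [jumpIntegral_insert _ hg _ hz, jumpIntegral_congr hm]
  simp only [Pi.add_apply, Pi.single_eq_same, multiplicity_eq_zero hz, zero_add,
    lintegral_jumpMeasure _ _ (hJs _), pow_one]
  rw [lintegral_lintegral_swap hsJ.aemeasurable]
  exact lintegral_congr fun s => lintegral_const_mul _ (hJm s)

/-- The mass of `B` splits into that of the underlying measure, where the one-point formula opens a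
new jump at `z`, and that of the jumps already present, where a multiplicity grows by one. -/
lemma MeckeFormula.lintegral_mul_apply_addJumpsLaw [MeasurableSingletonClass 𝕏]
    [NullSingletonClass η] (hQ : MeckeFormula Q η ρ) {n : ℕ} (x : Fin n → 𝕏)
    {g : Measure 𝕏 → ℝ≥0∞} (hg : Measurable g) {B : Set 𝕏} (hB : MeasurableSet B) :
    ∫⁻ μ, g μ * μ B ∂addJumpsLaw Q (jumpMeasure ρ) x
      = ∫⁻ z, B.indicator 1 z *
          ∫⁻ μ, g μ ∂addJumpsLaw Q (jumpMeasure ρ) (Fin.cons z x : Fin (n + 1) → 𝕏) ∂η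
        + ∑ y ∈ distinctValues x, B.indicator 1 y *
          ∫⁻ μ, g μ ∂addJumpsLaw Q (jumpMeasure ρ) (Fin.cons y x : Fin (n + 1) → 𝕏) := by
  classical
  have hgB : Measurable fun μ => g μ * μ B := hg.mul (Measure.measurable_coe hB)
  have hJ := measurable_jumpIntegral (j := jumpMeasure ρ) (distinctValues x) (multiplicity x) hg
  have hJB : Measurable fun μ₀ =>
      jumpIntegral (jumpMeasure ρ) (distinctValues x) (multiplicity x) g μ₀ * μ₀ B :=
    hJ.mul (Measure.measurable_coe hB)
  rw [lintegral_addJumpsLaw _ hgB]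
  simp only [jumpIntegral_mul_apply (j := jumpMeasure ρ) jumpMeasure_succ _ _ hg hB]
  rw [lintegral_add_left hJB, hQ _ hJ B hB,
    lintegral_finsetSum _ fun y _ => (measurable_jumpIntegral _ _ hg).const_mul _]
  congr 1
  · rw [← lintegral_indicator hB]
    -- Non-atomicity of `η`: a new draw almost surely avoids the finitely many old values.
    have hae : ∀ᵐ z ∂η, z ∉ distinctValues x :=
      measure_eq_zero_iff_ae_notMem.1 ((distinctValues x).finite_toSet.measure_zero η)
    refine lintegral_congr_ae ?_
    filter_upwards [hae] with z hz
    rw [lintegral_addJumpsLaw_cons x hz hg]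
    by_cases hzB : z ∈ B <;> simp [hzB]
  · refine Finset.sum_congr rfl fun y hy => ?_
    rw [lintegral_const_mul _ (measurable_jumpIntegral _ _ hg), lintegral_addJumpsLaw _ hg,
      distinctValues_cons, multiplicity_cons, Finset.insert_eq_of_mem hy]

/-- The multivariate Mecke formula: integrating a completely random measure against the product of
its values on `n` sets amounts to adding independent jumps at the distinct values of a sample. -/
theorem MeckeFormula.lintegral_mul_prod [MeasurableEq 𝕏] [IsSFiniteKernel ρ]
    [IsFiniteMeasure η] [NullSingletonClass η] (hQ : MeckeFormula Q η ρ) {n : ℕ}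
    {B : Fin n → Set 𝕏} (hB : ∀ i, MeasurableSet (B i))
    {g : Measure 𝕏 → ℝ≥0∞} (hg : Measurable g) :
    ∫⁻ μ, g μ * ∏ i, μ (B i) ∂Q
      = ∫⁻ x, (∏ i, (B i).indicator 1 (x i)) * ∫⁻ μ, g μ ∂addJumpsLaw Q (jumpMeasure ρ) x
          ∂partitionMeasure η n := by
  induction n generalizing g with
  | zero =>
    have hx : distinctValues (Fin.elim0 : Fin 0 → 𝕏) = ∅ := by simp [distinctValues]
    have hmeas := measurable_lintegral_addJumpsLaw (ρ := ρ) (Q := Q) (n := 0) hg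
    simp only [Finset.univ_eq_empty, Finset.prod_empty, mul_one, one_mul]
    rw [partitionMeasure, lintegral_dirac' _ hmeas, lintegral_addJumpsLaw _ hg]
    simp only [hx, jumpIntegral_empty]
  | succ n ih =>
    have hg0 : Measurable fun μ => g μ * μ (B 0) := hg.mul (Measure.measurable_coe (hB 0))
    have hT := measurable_lintegral_addJumpsLaw (ρ := ρ) (Q := Q) (n := n + 1) hg
    have hH : Measurable fun x : Fin (n + 1) → 𝕏 => (∏ i, (B i).indicator 1 (x i)) *
        ∫⁻ μ, g μ ∂addJumpsLaw Q (jumpMeasure ρ) x :=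
      (Finset.measurable_prod _ fun i _ =>
        (measurable_one.indicator (hB i)).comp (measurable_pi_apply i)).mul hT
    rw [lintegral_partitionMeasure_succ hH]
    simp only [Fin.prod_univ_succ, ← mul_assoc]
    -- The factor `μ (B 0)` is absorbed into `g`, which is why the induction is over all `g`.
    rw [ih (fun i => hB i.succ) hg0]
    refine lintegral_congr fun x => ?_
    rw [hQ.lintegral_mul_apply_addJumpsLaw x hg (hB 0)]
    have hT0 : Measurable fun z : 𝕏 => (B 0).indicator 1 z *
        ∫⁻ μ, g μ ∂addJumpsLaw Q (jumpMeasure ρ) (Fin.cons z x : Fin (n + 1) → 𝕏) :=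
      (measurable_one.indicator (hB 0)).mul
        (hT.comp (measurable_cons measurable_id measurable_const))
    simp only [Fin.cons_zero, Fin.cons_succ, mul_add, Finset.mul_sum]
    congr 1
    · rw [← lintegral_const_mul _ hT0]
      exact lintegral_congr fun z => by ring
    · exact Finset.sum_congr rfl fun y _ => by ring

end MultivariateMecke

/-! ### Tilted laws and the effect of normalization on the tilt. -/

section Tilting

variable {𝕏 : Type*} [MeasurableSpace 𝕏]

/-- The unnormalized density of the law tilted by `h`. -/
def tiltDensity (h : ℝ≥0 → ℝ) (μ : Measure 𝕏) : ℝ≥0∞ :=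
  ENNReal.ofReal (h (μ Set.univ).toNNReal)

lemma measurable_tiltDensity {h : ℝ≥0 → ℝ} (hh : Measurable h) :
    Measurable (tiltDensity h : Measure 𝕏 → ℝ≥0∞) :=
  ENNReal.measurable_ofReal.comp
    (hh.comp (ENNReal.measurable_toNNReal.comp (Measure.measurable_coe .univ)))

lemma measurable_polyTilt {h : ℝ≥0 → ℝ} (hh : Measurable h) (r : ℝ) :
    Measurable (polyTilt h r) :=
  hh.mul (measurable_coe_nnreal_real.pow_const _)

lemma measurable_normalizeMeasure :
    Measurable (normalizeMeasure : Measure 𝕏 → Measure 𝕏) :=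
  Measure.measurable_of_measurable_coe _ fun B hB => by
    simp only [normalizeMeasure, Measure.smul_apply, smul_eq_mul]
    exact (Measure.measurable_coe .univ).inv.mul (Measure.measurable_coe hB)

lemma tiltedLaw_eq_smul_withDensity (Q : Measure (Measure 𝕏)) (h : ℝ≥0 → ℝ) :
    tiltedLaw Q h = (tiltConst Q h)⁻¹ • Q.withDensity (tiltDensity h) := rfl

lemma tiltedLaw_apply (Q : Measure (Measure 𝕏)) (h : ℝ≥0 → ℝ) {A : Set (Measure 𝕏)}
    (hA : MeasurableSet A) :
    tiltedLaw Q h A = (tiltConst Q h)⁻¹ * ∫⁻ μ, A.indicator 1 μ * tiltDensity h μ ∂Q := by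
  rw [tiltedLaw, Measure.smul_apply, withDensity_apply _ hA, smul_eq_mul,
    ← lintegral_indicator hA]
  congr 1
  refine lintegral_congr fun μ => ?_
  by_cases hμ : μ ∈ A <;> simp [hμ, tiltDensity]

lemma tiltedLaw_univ (Q : Measure (Measure 𝕏)) (h : ℝ≥0 → ℝ) :
    tiltedLaw Q h Set.univ = (tiltConst Q h)⁻¹ * tiltConst Q h := by
  rw [tiltedLaw_apply _ _ .univ]
  simp [tiltConst, tiltDensity]

lemma tiltConst_smul (a : ℝ≥0∞) (Q : Measure (Measure 𝕏)) (h : ℝ≥0 → ℝ) :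
    tiltConst (a • Q) h = a * tiltConst Q h := lintegral_smul_measure _ _

/-- This scale invariance makes jump measures and normalized jump laws give the same posterior. -/
lemma tiltedLaw_smul {a : ℝ≥0∞} (h0 : a ≠ 0) (htop : a ≠ ∞) (Q : Measure (Measure 𝕏))
    (h : ℝ≥0 → ℝ) : tiltedLaw (a • Q) h = tiltedLaw Q h := by
  rw [tiltedLaw, tiltConst_smul, withDensity_smul_measure, smul_smul,
    ENNReal.mul_inv (.inl h0) (.inl htop), mul_assoc, mul_comm _ a, ← mul_assoc,
    ENNReal.inv_mul_cancel h0 htop, one_mul]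
  rfl

/-- The `n` normalizations contribute total mass to the power `-n`, which moves the exponent from
`q` to `n + q`. -/
lemma tiltDensity_mul_prod_normalizeMeasure {n : ℕ} (h : ℝ≥0 → ℝ) (q : ℝ) {μ : Measure 𝕏}
    (h0 : 0 < μ Set.univ) (htop : μ Set.univ < ∞) (B : Fin n → Set 𝕏) :
    tiltDensity (polyTilt h q) μ * ∏ i, normalizeMeasure μ (B i)
      = tiltDensity (polyTilt h (n + q)) μ * ∏ i, μ (B i) := by
  set t := (μ Set.univ).toNNReal with ht
  have hT : μ Set.univ = t := (ENNReal.coe_toNNReal htop.ne).symm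
  have htpos : (0 : ℝ) < t := by
    rw [hT] at h0
    exact_mod_cast h0
  have hpow : h t * (t : ℝ) ^ (-(n + q)) = h t * (t : ℝ) ^ (-q) * ((t : ℝ)⁻¹) ^ n := by
    rw [neg_add, Real.rpow_add htpos, Real.rpow_neg htpos.le, Real.rpow_natCast, inv_pow]
    ring
  have hinv : ENNReal.ofReal ((t : ℝ)⁻¹ ^ n) = (μ Set.univ)⁻¹ ^ n := by
    rw [ENNReal.ofReal_pow (by positivity), ENNReal.ofReal_inv_of_pos htpos,
      ENNReal.ofReal_coe_nnreal, hT]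
  simp only [tiltDensity, polyTilt, ← ht, hpow, normalizeMeasure, Measure.smul_apply, smul_eq_mul,
    Finset.prod_mul_distrib, Finset.prod_const, Finset.card_univ, Fintype.card_fin]
  rw [ENNReal.ofReal_mul' (q := (t : ℝ)⁻¹ ^ n) (by positivity), hinv, mul_assoc]

/-- The tilted law has mass `c⁻¹ * c` for the constant `c`; in `ℝ≥0∞` this is `0`, not `1`, when `c`
is `0` or `∞`. -/
lemma tiltConst_ne_zero_and_ne_top {Q : Measure (Measure 𝕏)} {h : ℝ≥0 → ℝ}
    {Ω' : Type*} [MeasurableSpace Ω'] {P' : Measure Ω'} [IsProbabilityMeasure P']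
    {M : Ω' → Measure 𝕏} (hM : Measurable M) (hlaw : P'.map M = tiltedLaw Q h) :
    tiltConst Q h ≠ 0 ∧ tiltConst Q h ≠ ∞ := by
  have h1 : (tiltConst Q h)⁻¹ * tiltConst Q h = 1 := by
    rw [← tiltedLaw_univ, ← hlaw, Measure.map_apply hM .univ, Set.preimage_univ, measure_univ]
  constructor <;> intro h0 <;> simp [h0] at h1

lemma ext_of_rectangles {𝕏 : Type*} [MeasurableSpace 𝕏] {n : ℕ} {m₁ m₂ : Measure (Fin n → 𝕏)} [IsFiniteMeasure m₁]
    (h : ∀ B : Fin n → Set 𝕏, (∀ i, MeasurableSet (B i)) →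
      m₁ (Set.univ.pi B) = m₂ (Set.univ.pi B)) : m₁ = m₂ := by
  refine ext_of_generate_finite _ generateFrom_pi.symm isPiSystem_pi ?_ ?_
  · rintro _ ⟨B, hB, rfl⟩
    exact h B fun i => hB i trivial
  · simpa using h (fun _ => Set.univ) fun _ => .univ

end Tilting

/-! ### Jump measures versus normalized jump laws. -/

section Jumps

variable {𝕏 : Type*} [MeasurableSpace 𝕏]

lemma addJumpsLaw_congr {n : ℕ} (Q : Measure (Measure 𝕏)) {j j' : 𝕏 → ℕ → Measure PosReal}
    {x : Fin n → 𝕏} (h : ∀ i, j (x i) = j' (x i)) : addJumpsLaw Q j x = addJumpsLaw Q j' x := by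
  have : (fun y : ↥(distinctValues x) => j y (multiplicity x y))
      = fun y : ↥(distinctValues x) => j' y (multiplicity x y) := by
    funext y
    obtain ⟨i, hi⟩ := (mem_distinctValues x).1 y.2
    rw [← hi, h i]
  rw [addJumpsLaw, this]
  rfl

lemma jumpMeasure_univ (ρ : Kernel 𝕏 PosReal) (y : 𝕏) (m : ℕ) :
    jumpMeasure ρ y m Set.univ = jumpMoment ρ y m := by
  rw [jumpMeasure, withDensity_apply _ .univ, Measure.restrict_univ, jumpMoment]

/-- Normalizing the jump measures, when this is possible, normalizes the law with added jumps. -/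
lemma addJumpsLaw_jumpLaw {n : ℕ} {Q : Measure (Measure 𝕏)} [SFinite Q] {ρ : Kernel 𝕏 PosReal}
    {x : Fin n → 𝕏} (hne : addJumpsLaw Q (jumpMeasure ρ) x ≠ 0)
    (hfin : ∀ y ∈ distinctValues x, jumpMoment ρ y (multiplicity x y) < ∞) :
    (∀ y ∈ distinctValues x, 0 < jumpMoment ρ y (multiplicity x y)) ∧
      ∃ a : ℝ≥0∞, a ≠ 0 ∧ a ≠ ∞ ∧
        addJumpsLaw Q (jumpLaw ρ) x = a • addJumpsLaw Q (jumpMeasure ρ) x := by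
  let D := distinctValues x
  have hfinD : ∀ y : ↥D, IsFiniteMeasure (jumpMeasure ρ y (multiplicity x y)) := fun y =>
    ⟨by rw [jumpMeasure_univ]; exact hfin y y.2⟩
  -- A single vanishing moment would annihilate the product measure, hence the whole law with added
  -- jumps.
  have hpos : ∀ y : ↥D, jumpMoment ρ y (multiplicity x y) ≠ 0 := by
    intro y hy
    refine hne ?_
    have hpi : (Measure.pi fun y : ↥D => jumpMeasure ρ y (multiplicity x y)) = 0 := by
      rw [← Measure.measure_univ_eq_zero, Measure.pi_univ]
      exact Finset.prod_eq_zero (Finset.mem_univ y) (by rw [jumpMeasure_univ, hy])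
    rw [addJumpsLaw, hpi, Measure.prod_zero, Measure.map_zero]
  have hinv : ∀ y : ↥D, (jumpMoment ρ y (multiplicity x y))⁻¹ ≠ ∞ := fun y =>
    ENNReal.inv_ne_top.2 (hpos y)
  refine ⟨fun y hy => pos_iff_ne_zero.2 (hpos ⟨y, hy⟩),
    ∏ y : ↥D, (jumpMoment ρ y (multiplicity x y))⁻¹,
    Finset.prod_ne_zero_iff.2 fun y _ => ENNReal.inv_ne_zero.2 (hfin y y.2).ne,
    ENNReal.prod_ne_top fun y _ => hinv y, ?_⟩
  have hfinL : ∀ y : ↥D, IsFiniteMeasure (jumpLaw ρ y (multiplicity x y)) := fun y =>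
    (jumpMeasure ρ y (multiplicity x y)).smul_finite (hinv y)
  have hpi : (Measure.pi fun y : ↥D => jumpLaw ρ y (multiplicity x y))
      = (∏ y : ↥D, (jumpMoment ρ y (multiplicity x y))⁻¹) •
        Measure.pi fun y : ↥D => jumpMeasure ρ y (multiplicity x y) := by
    refine Measure.pi_eq fun s hs => ?_
    rw [Measure.smul_apply, Measure.pi_pi, smul_eq_mul, ← Finset.prod_mul_distrib]
    rfl
  rw [addJumpsLaw, addJumpsLaw, hpi, Measure.prod_smul_right, Measure.map_smul]

end Jumps

/-! ### Joint law of measure and sample, and Bayes' formula. -/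

section Posterior

variable {𝕏 : Type*} [MeasurableSpace 𝕏] [MeasurableEq 𝕏] {ρ : Kernel 𝕏 PosReal}
  [IsSFiniteKernel ρ] [∀ y, SigmaFinite (ρ y)] {Q : Measure (Measure 𝕏)}

lemma measurable_tiltConst_addJumpsLaw [SFinite Q] {h : ℝ≥0 → ℝ} (hh : Measurable h) {n : ℕ} :
    Measurable fun x : Fin n → 𝕏 => tiltConst (addJumpsLaw Q (jumpMeasure ρ) x) h :=
  measurable_lintegral_addJumpsLaw (measurable_tiltDensity hh)

open scoped Classical in
/-- The posterior of a tilted completely random measure. -/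
def posteriorKernel (ρ : Kernel 𝕏 PosReal) [IsSFiniteKernel ρ] [∀ y, SigmaFinite (ρ y)]
    (Q : Measure (Measure 𝕏)) [SFinite Q] {h : ℝ≥0 → ℝ} (hh : Measurable h) (n : ℕ) :
    Kernel (Fin n → 𝕏) (Measure 𝕏) where
  toFun x :=
    -- Where the constant is `0` or `∞`, the default value `Q` keeps the kernel Markov when `Q` is a
    -- probability measure.
    if 0 < tiltConst (addJumpsLaw Q (jumpMeasure ρ) x) h ∧
        tiltConst (addJumpsLaw Q (jumpMeasure ρ) x) h < ∞
    then tiltedLaw (addJumpsLaw Q (jumpMeasure ρ) x) h else Q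
  measurable' := by
    have hd := measurable_tiltDensity (𝕏 := 𝕏) hh
    have hc := measurable_tiltConst_addJumpsLaw (ρ := ρ) (Q := Q) (n := n) hh
    refine Measurable.ite ((measurableSet_lt measurable_const hc).inter
      (measurableSet_lt hc measurable_const)) ?_ measurable_const
    refine Measure.measurable_of_measurable_coe _ fun A hA => ?_
    simp only [tiltedLaw_apply _ _ hA]
    exact hc.inv.mul (measurable_lintegral_addJumpsLaw ((measurable_one.indicator hA).mul hd))

open scoped Classical in
lemma posteriorKernel_apply [SFinite Q] {h : ℝ≥0 → ℝ} (hh : Measurable h) {n : ℕ}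
    (x : Fin n → 𝕏) :
    posteriorKernel ρ Q hh n x =
      if 0 < tiltConst (addJumpsLaw Q (jumpMeasure ρ) x) h ∧
        tiltConst (addJumpsLaw Q (jumpMeasure ρ) x) h < ∞
      then tiltedLaw (addJumpsLaw Q (jumpMeasure ρ) x) h else Q := rfl

instance isMarkovKernel_posteriorKernel [IsProbabilityMeasure Q] {h : ℝ≥0 → ℝ} (hh : Measurable h)
    (n : ℕ) : IsMarkovKernel (posteriorKernel ρ Q hh n) := by
  refine ⟨fun x => ?_⟩
  rw [posteriorKernel_apply]
  split_ifs with hx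
  · exact ⟨by rw [tiltedLaw_univ, ENNReal.inv_mul_cancel hx.1.ne' hx.2.ne]⟩
  · infer_instance

/-- Bayes' formula with the denominator cleared. It survives a zero constant, where both sides
vanish whatever the default value of the kernel. -/
lemma tiltConst_mul_posteriorKernel_apply [SFinite Q] {h : ℝ≥0 → ℝ} (hh : Measurable h) {n : ℕ}
    {x : Fin n → 𝕏} (hx : tiltConst (addJumpsLaw Q (jumpMeasure ρ) x) h < ∞)
    {A : Set (Measure 𝕏)} (hA : MeasurableSet A) :
    tiltConst (addJumpsLaw Q (jumpMeasure ρ) x) h * posteriorKernel ρ Q hh n x A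
      = ∫⁻ μ, A.indicator 1 μ * tiltDensity h μ ∂addJumpsLaw Q (jumpMeasure ρ) x := by
  rcases eq_zero_or_pos (tiltConst (addJumpsLaw Q (jumpMeasure ρ) x) h) with h0 | h0
  · rw [h0, zero_mul]
    refine (le_antisymm ?_ zero_le).symm
    rw [← h0]
    refine lintegral_mono fun μ => mul_le_of_le_one_left' ?_
    exact Set.indicator_le_self' (fun _ _ => zero_le) μ
  · rw [posteriorKernel_apply, if_pos ⟨h0, hx⟩, tiltedLaw_apply _ _ hA, ← mul_assoc,
      ENNReal.mul_inv_cancel h0.ne' hx.ne, one_mul]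

variable {η : Measure 𝕏} [IsFiniteMeasure η] [NullSingletonClass η] [IsProbabilityMeasure Q]
  {h' : ℝ≥0 → ℝ} {q : ℝ} {Ω' : Type*} [MeasurableSpace Ω'] {P' : Measure Ω'}
  [IsProbabilityMeasure P'] {M : Ω' → Measure 𝕏} {n : ℕ} {X : Fin n → Ω' → 𝕏}

/-- The joint law of a tilted completely random measure and of a sample from it. -/
lemma map_restrict_sample (hQ : MeckeFormula Q η ρ)
    (hT : ∀ᵐ μ ∂Q, 0 < μ Set.univ ∧ μ Set.univ < ∞) (hh' : Measurable h') (hM : Measurable M)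
    (hlaw : P'.map M = tiltedLaw Q (polyTilt h' q)) (hX : IsCondIIDSample X M P')
    {A : Set (Measure 𝕏)} (hA : MeasurableSet A) :
    (P'.restrict (M ⁻¹' A)).map (fun ω i => X i ω)
      = (tiltConst Q (polyTilt h' q))⁻¹ • (partitionMeasure η n).withDensity fun x =>
          ∫⁻ μ, A.indicator 1 μ * tiltDensity (polyTilt h' (n + q)) μ
            ∂addJumpsLaw Q (jumpMeasure ρ) x := by
  have hXm : Measurable fun ω i => X i ω := measurable_pi_iff.2 hX.measurable_obs
  refine ext_of_rectangles fun B hB => ?_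
  have hBm : MeasurableSet (Set.univ.pi B) := MeasurableSet.univ_pi hB
  have hG : Measurable fun μ : Measure 𝕏 => ∏ i, normalizeMeasure μ (B i) :=
    Finset.measurable_prod _ fun i _ =>
      (Measure.measurable_coe (hB i)).comp measurable_normalizeMeasure
  have hd := measurable_tiltDensity (𝕏 := 𝕏) (measurable_polyTilt hh' q)
  have hdn := measurable_tiltDensity (𝕏 := 𝕏) (measurable_polyTilt hh' (n + q))
  have hset : (fun ω i => X i ω) ⁻¹' (Set.univ.pi B) ∩ M ⁻¹' A
      = {ω | M ω ∈ A ∧ ∀ i, X i ω ∈ B i} := by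
    ext ω
    simp [and_comm]
  rw [Measure.map_apply hXm hBm, Measure.restrict_apply (hXm hBm), hset, hX.joint_law A hA B hB,
    ← setLIntegral_map hA hG hM, hlaw, ← lintegral_indicator hA,
    tiltedLaw_eq_smul_withDensity, lintegral_smul_measure,
    lintegral_withDensity_eq_lintegral_mul _ hd (hG.indicator hA), Measure.smul_apply,
    withDensity_apply _ hBm, ← lintegral_indicator hBm]
  congr 1
  have hg : Measurable fun μ : Measure 𝕏 =>
      A.indicator 1 μ * tiltDensity (polyTilt h' (n + q)) μ :=
    (measurable_one.indicator hA).mul hdn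
  refine (lintegral_congr_ae ?_).trans
    ((hQ.lintegral_mul_prod hB hg).trans (lintegral_congr fun x => ?_))
  · filter_upwards [hT] with μ hμ
    rw [mul_assoc, ← tiltDensity_mul_prod_normalizeMeasure h' q hμ.1 hμ.2]
    by_cases hμA : μ ∈ A <;> simp [hμA]
  · by_cases hx : ∀ i, x i ∈ B i
    · simp [hx]
    · have hx' : x ∉ Set.univ.pi B := fun h => hx fun i => h i trivial
      push Not at hx
      obtain ⟨i, hi⟩ := hx
      rw [Finset.prod_eq_zero (Finset.mem_univ i) (by simp [hi]), zero_mul,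
        Set.indicator_of_notMem hx']

/-- The law of a sample from a tilted completely random measure. -/
lemma map_sample (hQ : MeckeFormula Q η ρ)
    (hT : ∀ᵐ μ ∂Q, 0 < μ Set.univ ∧ μ Set.univ < ∞) (hh' : Measurable h') (hM : Measurable M)
    (hlaw : P'.map M = tiltedLaw Q (polyTilt h' q)) (hX : IsCondIIDSample X M P') :
    P'.map (fun ω i => X i ω)
      = (tiltConst Q (polyTilt h' q))⁻¹ • (partitionMeasure η n).withDensity fun x =>
          tiltConst (addJumpsLaw Q (jumpMeasure ρ) x) (polyTilt h' (n + q)) := by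
  have h := map_restrict_sample hQ hT hh' hM hlaw hX (A := Set.univ) .univ
  simpa [tiltConst, tiltDensity] using h

/-- Up to a nonzero factor this constant is the density of the sample, whose law has total mass one.
-/
lemma ae_tiltConst_lt_top (hQ : MeckeFormula Q η ρ)
    (hT : ∀ᵐ μ ∂Q, 0 < μ Set.univ ∧ μ Set.univ < ∞) (hh' : Measurable h') (hM : Measurable M)
    (hlaw : P'.map M = tiltedLaw Q (polyTilt h' q)) (hX : IsCondIIDSample X M P') :
    ∀ᵐ x ∂partitionMeasure η n,
      tiltConst (addJumpsLaw Q (jumpMeasure ρ) x) (polyTilt h' (n + q)) < ∞ := by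
  have hXm : Measurable fun ω i => X i ω := measurable_pi_iff.2 hX.measurable_obs
  obtain ⟨-, htop⟩ := tiltConst_ne_zero_and_ne_top hM hlaw
  have h1 := congrArg (fun m => m Set.univ) (map_sample hQ hT hh' hM hlaw hX)
  simp only [Measure.map_apply hXm .univ, Set.preimage_univ, measure_univ, Measure.smul_apply,
    withDensity_apply _ MeasurableSet.univ, Measure.restrict_univ, smul_eq_mul] at h1
  refine ae_lt_top (measurable_tiltConst_addJumpsLaw (measurable_polyTilt hh' (n + q))) fun h => ?_
  rw [h, ENNReal.mul_top (ENNReal.inv_ne_zero.2 htop)] at h1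
  exact ENNReal.one_ne_top h1

/-- Bayes' formula for tilted completely random measures. -/
theorem isCondLaw_posteriorKernel (hQ : MeckeFormula Q η ρ)
    (hT : ∀ᵐ μ ∂Q, 0 < μ Set.univ ∧ μ Set.univ < ∞) (hh' : Measurable h') (hM : Measurable M)
    (hlaw : P'.map M = tiltedLaw Q (polyTilt h' q)) (hX : IsCondIIDSample X M P') :
    IsCondLaw (posteriorKernel ρ Q (measurable_polyTilt hh' (n + q)) n) M (fun ω i => X i ω) P' := by
  refine ⟨inferInstance, ?_⟩
  set κ := posteriorKernel ρ Q (measurable_polyTilt hh' (n + q)) n with hκ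
  have hXm : Measurable fun ω i => X i ω := measurable_pi_iff.2 hX.measurable_obs
  have := Measure.isProbabilityMeasure_map (μ := P') (hXm.prodMk hM).aemeasurable
  have := Measure.isProbabilityMeasure_map (μ := P') hXm.aemeasurable
  have hc := measurable_tiltConst_addJumpsLaw (ρ := ρ) (Q := Q) (n := n)
    (measurable_polyTilt hh' (n + q))
  refine Measure.ext_prod fun {S A} hS hA => ?_
  have hκA : Measurable fun x => κ x A := κ.measurable_coe hA
  rw [Measure.map_apply (hXm.prodMk hM) (hS.prod hA), Measure.compProd_apply_prod hS hA,
    map_sample hQ hT hh' hM hlaw hX, Measure.restrict_smul, lintegral_smul_measure,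
    restrict_withDensity hS, lintegral_withDensity_eq_lintegral_mul _ hc hκA]
  have hset : (fun ω => ((fun i => X i ω : Fin n → 𝕏), M ω)) ⁻¹' S ×ˢ A
      = (fun ω i => X i ω) ⁻¹' S ∩ M ⁻¹' A := rfl
  rw [hset, ← Measure.restrict_apply (hXm hS), ← Measure.map_apply hXm hS,
    map_restrict_sample hQ hT hh' hM hlaw hX hA, Measure.smul_apply, withDensity_apply _ hS]
  congr 1
  refine lintegral_congr_ae (ae_restrict_of_ae ?_)
  filter_upwards [ae_tiltConst_lt_top hQ hT hh' hM hlaw hX] with x hx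
  exact (tiltConst_mul_posteriorKernel_apply _ hx hA).symm

lemma ae_sample_of_ae_partitionMeasure (hQ : MeckeFormula Q η ρ)
    (hT : ∀ᵐ μ ∂Q, 0 < μ Set.univ ∧ μ Set.univ < ∞) (hh' : Measurable h') (hM : Measurable M)
    (hlaw : P'.map M = tiltedLaw Q (polyTilt h' q)) (hX : IsCondIIDSample X M P')
    {p : (Fin n → 𝕏) → Prop} (hp : ∀ᵐ x ∂partitionMeasure η n, p x) :
    ∀ᵐ x ∂P'.map (fun ω i => X i ω), p x := by
  rw [map_sample hQ hT hh' hM hlaw hX]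
  exact Measure.ae_smul_measure ((withDensity_absolutelyContinuous _ _).ae_le hp) _

/-- A density is positive almost everywhere for the measure it defines. This holds under the law of
the sample, not in general under `partitionMeasure`. -/
lemma ae_tiltConst_pos (hQ : MeckeFormula Q η ρ)
    (hT : ∀ᵐ μ ∂Q, 0 < μ Set.univ ∧ μ Set.univ < ∞) (hh' : Measurable h') (hM : Measurable M)
    (hlaw : P'.map M = tiltedLaw Q (polyTilt h' q)) (hX : IsCondIIDSample X M P') :
    ∀ᵐ x ∂P'.map (fun ω i => X i ω),
      0 < tiltConst (addJumpsLaw Q (jumpMeasure ρ) x) (polyTilt h' (n + q)) := by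
  rw [map_sample hQ hT hh' hM hlaw hX]
  refine Measure.ae_smul_measure ?_ _
  rw [ae_withDensity_iff (measurable_tiltConst_addJumpsLaw (measurable_polyTilt hh' (n + q)))]
  exact ae_of_all _ fun x hx => pos_iff_ne_zero.2 hx

end Posterior

lemma IsCondLaw.map {S T U Ω' : Type*} [MeasurableSpace S] [MeasurableSpace T]
    [MeasurableSpace U] [MeasurableSpace Ω'] {κ : Kernel S T} {Θ : Ω' → T} {X : Ω' → S}
    {P' : Measure Ω'} [IsFiniteMeasure P'] (h : IsCondLaw κ Θ X P') (hΘ : Measurable Θ)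
    (hX : Measurable X) {f : T → U} (hf : Measurable f) :
    IsCondLaw (κ.map f) (fun ω => f (Θ ω)) X P' := by
  have := h.1
  refine ⟨Kernel.IsMarkovKernel.map κ hf, ?_⟩
  rw [Measure.compProd_map hf, ← h.2, Measure.map_map (by fun_prop) (hX.prodMk hΘ)]
  rfl

end

end TiltedCRM

/-! ### The posterior theorem. -/

open TiltedCRM

theorem theorem3p1
    {𝕏 : Type*} [MetricSpace 𝕏] [PolishSpace 𝕏] [MeasurableSpace 𝕏] [BorelSpace 𝕏]
    -- the intensity `ν(dx, ds) = η(dx) ρ_x(ds)`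
    (η : Measure 𝕏) [IsProbabilityMeasure η] [NullSingletonClass η]
    (ρ : Kernel 𝕏 TiltedCRM.PosReal) [IsSFiniteKernel ρ]
    (hν : TiltedCRM.IsCRMIntensity (η ⊗ₘ ρ))
    -- the completely random measure `μ(·) = ∫ s N(·, ds)`
    {Ω : Type*} [MeasurableSpace Ω] (P : Measure Ω) [IsProbabilityMeasure P]
    (N : Ω → Measure (𝕏 × TiltedCRM.PosReal))
    (hN : TiltedCRM.IsPoissonProcess N (η ⊗ₘ ρ) P)
    (μ : Ω → Measure 𝕏) (hμ : ∀ ω, μ ω = TiltedCRM.crmOf (N ω))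
    (hT : ∀ᵐ ω ∂P, 0 < μ ω Set.univ ∧ μ ω Set.univ < ∞)
    -- the tilt `h(x) = h'(x) x^{-q}`
    (h' : ℝ≥0 → ℝ) (hh'_meas : Measurable h') (hh'_pos : ∀ x, 0 < h' x)
    (q : ℝ) (hq : 0 ≤ q)
    (hfin : TiltedCRM.tiltConst (P.map μ) (TiltedCRM.polyTilt h' q) < ∞)
    -- the tilted completely random measure `μt` and the observations `X₁, …, Xₙ`
    {Ω' : Type*} [MeasurableSpace Ω'] (P' : Measure Ω') [IsProbabilityMeasure P']
    (μt : Ω' → Measure 𝕏) (hμt_meas : Measurable μt)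
    (hμt : P'.map μt = TiltedCRM.tiltedLaw (P.map μ) (TiltedCRM.polyTilt h' q))
    (n : ℕ) (X : Fin n → Ω' → 𝕏) (hX : TiltedCRM.IsCondIIDSample X μt P') :
    ∃ κ : Kernel (Fin n → 𝕏) (Measure 𝕏),
      -- `κ` is the posterior of `μt`, and its image under normalization is the posterior of `Gt`
      TiltedCRM.IsCondLaw κ μt (fun ω i => X i ω) P' ∧
      TiltedCRM.IsCondLaw (κ.map TiltedCRM.normalizeMeasure)
        (fun ω => TiltedCRM.normalizeMeasure (μt ω)) (fun ω i => X i ω) P' ∧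
      ∀ᵐ x ∂(P'.map fun ω i => X i ω),
        -- the posterior with jump measures `s^{n_k} ρ_{Y_k}(ds)`, up to normalization
        (0 < TiltedCRM.tiltConst
            (TiltedCRM.addJumpsLaw (P.map μ) (TiltedCRM.jumpMeasure ρ) x)
            (TiltedCRM.polyTilt h' (n + q)) ∧
          TiltedCRM.tiltConst
            (TiltedCRM.addJumpsLaw (P.map μ) (TiltedCRM.jumpMeasure ρ) x)
            (TiltedCRM.polyTilt h' (n + q)) < ∞ ∧
          κ x = TiltedCRM.tiltedLaw
            (TiltedCRM.addJumpsLaw (P.map μ) (TiltedCRM.jumpMeasure ρ) x)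
            (TiltedCRM.polyTilt h' (n + q))) ∧
        -- the posterior with normalized jump laws, whenever these exist
        ((∀ y ∈ TiltedCRM.distinctValues x,
            TiltedCRM.jumpMoment ρ y (TiltedCRM.multiplicity x y) < ∞) →
          (∀ y ∈ TiltedCRM.distinctValues x,
            0 < TiltedCRM.jumpMoment ρ y (TiltedCRM.multiplicity x y)) ∧
          0 < TiltedCRM.tiltConst
            (TiltedCRM.addJumpsLaw (P.map μ) (TiltedCRM.jumpLaw ρ) x)
            (TiltedCRM.polyTilt h' (n + q)) ∧
          TiltedCRM.tiltConst
            (TiltedCRM.addJumpsLaw (P.map μ) (TiltedCRM.jumpLaw ρ) x)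
            (TiltedCRM.polyTilt h' (n + q)) < ∞ ∧
          κ x = TiltedCRM.tiltedLaw
            (TiltedCRM.addJumpsLaw (P.map μ) (TiltedCRM.jumpLaw ρ) x)
            (TiltedCRM.polyTilt h' (n + q))) := by
  -- The argument runs with an everywhere σ-finite version `ρ'` of the kernel, which leaves the
  -- intensity, hence the Poisson process, unchanged.
  obtain ⟨ρ', hρ's, hρ'ρ, hρ'fin⟩ := hν.exists_kernel
  have hρ'σ : ∀ y, SigmaFinite (ρ' y) := fun y => sigmaFinite_of_lintegral_min_lt_top (hρ'fin y)
  have hσ : SigmaFinite (η ⊗ₘ ρ') := sigmaFinite_compProd hρ'fin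
  obtain rfl : μ = fun ω => crmOf (N ω) := funext hμ
  have hμm : Measurable fun ω => crmOf (N ω) := measurable_crmOf.comp hN.measurable
  set Q := P.map fun ω => crmOf (N ω) with hQdef
  have hQprob : IsProbabilityMeasure Q := Measure.isProbabilityMeasure_map hμm.aemeasurable
  have hN' : IsPoissonProcess N (η ⊗ₘ ρ') P := by rwa [Measure.compProd_congr hρ'ρ]
  have hQ : MeckeFormula Q η ρ' := fun g hg B hB => lintegral_mul_apply_crm hN' hg hB
  have huniv : Measurable fun m : Measure 𝕏 => m Set.univ := Measure.measurable_coe .univ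
  have hT' : ∀ᵐ m ∂Q, 0 < m Set.univ ∧ m Set.univ < ∞ :=
    (ae_map_iff hμm.aemeasurable ((measurableSet_lt measurable_const huniv).inter
      (measurableSet_lt huniv measurable_const))).2 hT
  have hXm : Measurable fun ω i => X i ω := measurable_pi_iff.2 hX.measurable_obs
  have hκ := isCondLaw_posteriorKernel hQ hT' hh'_meas hμt_meas hμt hX
  refine ⟨posteriorKernel ρ' Q (measurable_polyTilt hh'_meas (n + q)) n, hκ,
    hκ.map hμt_meas hXm measurable_normalizeMeasure, ?_⟩
  filter_upwards [ae_tiltConst_pos hQ hT' hh'_meas hμt_meas hμt hX,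
    ae_sample_of_ae_partitionMeasure hQ hT' hh'_meas hμt_meas hμt hX
      (ae_tiltConst_lt_top hQ hT' hh'_meas hμt_meas hμt hX),
    ae_sample_of_ae_partitionMeasure hQ hT' hh'_meas hμt_meas hμt hX
      (ae_partitionMeasure hρ'ρ n)] with x hpos hlt hx
  have hκx := posteriorKernel_apply (ρ := ρ') (Q := Q) (measurable_polyTilt hh'_meas (n + q)) x
  rw [if_pos ⟨hpos, hlt⟩] at hκx
  -- Almost every sample has all its values where `ρ'` and `ρ` agree, so the formulas pass back to
  -- `ρ`.
  have hlaw : addJumpsLaw Q (jumpMeasure ρ') x = addJumpsLaw Q (jumpMeasure ρ) x :=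
    addJumpsLaw_congr Q fun i => by funext m; rw [jumpMeasure, jumpMeasure, hx i]
  rw [hlaw] at hpos hlt hκx
  refine ⟨⟨hpos, hlt, hκx⟩, fun hfinx => ?_⟩
  -- The positive constant rules out the zero law; this is what forces the jump moments to be
  -- positive.
  have hne : addJumpsLaw Q (jumpMeasure ρ) x ≠ 0 := fun h => by
    simp [h, tiltConst] at hpos
  obtain ⟨hmom, a, ha0, hatop, ha⟩ := addJumpsLaw_jumpLaw hne hfinx
  rw [ha, tiltConst_smul, tiltedLaw_smul ha0 hatop]
  exact ⟨hmom, ENNReal.mul_pos ha0 hpos.ne', ENNReal.mul_lt_top hatop.lt_top hlt, hκx⟩
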